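/- **Theorem (an extension of the Lax-Wendroff theorem).** Let $d\ge 1$, let $\Omega\subset\mathbb R^d$ be a bounded open polyhedral set, $T>0$, $F:\mathbb R\to\mathbb R^d$ continuous and $u_0\in L^1(\Omega)$. *Meshes.* A mesh $\mathcal M$ is a finite partition of $\Omega$ into measurable cells $K$ with $|K|>0$, the boundary of each of which is a finite union of faces $\sigma\in\mathcal E_K$. Each face is a measurable part of a hyperplane, faces of the same cell overlap only in sets of zero $(d-1)$-dimensional measure, and each face $\sigma$ of $K$ has a unit normal $n_{K,\sigma}$ outward to $K$ (near almost every point of $\sigma$, $K$ lies exactly on the side opposite to $n_{K,\sigma}$). We write $\sigma=K|L$ if $\sigma$ is a face of the two distinct cells $K,L$ ($\sigma$ is then internal); all other faces lie on $\partial\Omega$. $|\cdot|$ denotes the Lebesgue measure of dimension $d$ (cells) or $d-1$ (faces), and $h_{\mathcal M}$ is the largest diameter of a cell. Each mesh comes with points $x_K\in K$ and with a dual mesh: a measurable partition $(D_\sigma)_\sigma$ of $\Omega$ indexed by the faces, with $D_\sigma\subset K\cup L$ and $|D_\sigma|>0$ if $\sigma=K|L$. A time grid $\mathcal T$ is given by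 $0=t_0<t_1<\dots<t_N=T$; its step $\delta t_{\mathcal T}$ is $\max_n (t_{n+1}-t_n)$. *Scheme.* Let $(\mathcal M^{(m)})_{m\in\mathbb N}$ be such meshes and $(\mathcal T^{(m)})_{m\in\mathbb N}$ such time grids, with $h_{\mathcal M^{(m)}}\to0$ and $\delta t_{\mathcal T^{(m)}}\to0$. For each $m$ (omitted from the notation below), let numerical fluxes $F_\sigma^n\in\mathbb R^d$ ($0\le n<N$, $\sigma$ a face) and reals $u_K^n$ ($0\le n\le N$) satisfy $$u_K^0=\frac1{|K|}\int_K u_0\,dx,\qquad \frac{|K|}{t_{n+1}-t_n}(u_K^{n+1}-u_K^n)+\sum_{\sigma\in\mathcal E_K}|\sigma|\,F_\sigma^n\cdot n_{K,\sigma}=0\quad(K\in\mathcal M,\ 0\le n<N),$$ and let $u^{(m)}$ be the function equal to $u_K^n$ on $K\times(t_n,t_{n+1}]$. The fluxes through the faces on $\partial\Omega$ are arbitrary. *Assumptions.* Suppose that $u^{(m)}\to\bar u$ in $L^1(\Omega\times(0,T))$ and that (i) $F(u^{(m)})\to F(\bar u)$ in $L^1(\Omega\times(0,T))$; (ii) $\max_{\sigma=K|L}\dfrac{|\sigma|\,|x_L-x_K|}{|D_\sigma|}$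 is bounded uniformly in $m$; (iii) there is $C_F$, independent of $m$, with $|F_\sigma^n-F(u_K^n)|\le C_F|u_K^n-u_L^n|$ and $|F_\sigma^n-F(u_L^n)|\le C_F|u_K^n-u_L^n|$ for all $m$, all $n<N^{(m)}$ and all internal faces $\sigma=K|L$ of $\mathcal M^{(m)}$; (iv) $\max_{K}\max_{\sigma\in\mathcal E_K}\dfrac{|D_\sigma|}{|K|}$ and the number of faces of each cell are bounded uniformly in $m$. *Conclusion.* Then $\bar u$ is a weak solution of $\partial_t u+\operatorname{div}F(u)=0$ with initial datum $u_0$: for every $\varphi\in C_c^\infty(\Omega\times[0,T))$, $$-\int_0^T\!\!\int_\Omega\bigl(\bar u\,\partial_t\varphi+F(\bar u)\cdot\nabla\varphi\bigr)\,dx\,dt=\int_\Omega u_0(x)\,\varphi(x,0)\,dx .$$ -/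

import Mathlib

open MeasureTheory Set Filter Topology
open scoped ContDiff

noncomputable section

/-- The Euclidean space `ℝ^d`. -/
abbrev Space (d : ℕ) : Type := EuclideanSpace ℝ (Fin d)

/-- A polyhedral mesh of `Ω ⊆ ℝ^d`: a finite partition of `Ω` into measurable cells `K`, each of which
has a boundary that is a finite union of faces, a face being a part of a hyperplane.
Distinct faces of one cell overlap only in a set of zero `(d-1)`-dimensional measure; each face of a
cell has a unit normal vector pointing out of the cell; a face that does not belong to two
distinct cells lies on the boundary of `Ω`. The measure `μHE[d - 1]` is the `(d-1)`-dimensional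
Lebesgue (surface) measure. -/
structure PolyhedralMesh {d : ℕ} (Ω : Set (Space d)) where
  /-- the index set of the cells -/
  Cell : Type
  /-- the index set of the faces -/
  Face : Type
  fintypeCell : Fintype Cell
  fintypeFace : Fintype Face
  /-- the cells, as subsets of `Ω` -/
  cell : Cell → Set (Space d)
  /-- the faces, as subsets of `ℝ^d` -/
  face : Face → Set (Space d)
  /-- the set of the faces of a cell -/
  facesOf : Cell → Finset Face
  /-- the unit normal vector to a face of a cell, outward to that cell (irrelevant for a face that is
  not a face of the cell) -/
  normal : Cell → Face → Space d
  measurableSet_cell : ∀ K, MeasurableSet (cell K)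
  volume_cell_pos : ∀ K, 0 < volume (cell K)
  pairwise_disjoint_cell : Pairwise fun K L => Disjoint (cell K) (cell L)
  iUnion_cell : ⋃ K, cell K = Ω
  exists_mem_facesOf : ∀ σ, ∃ K, σ ∈ facesOf K
  measurableSet_face : ∀ σ, MeasurableSet (face σ)
  frontier_cell : ∀ K, frontier (cell K) = ⋃ σ ∈ facesOf K, face σ
  aedisjoint_face : ∀ K, ∀ σ ∈ facesOf K, ∀ τ ∈ facesOf K, σ ≠ τ →
    μHE[d - 1] (face σ ∩ face τ) = 0
  norm_normal : ∀ K, ∀ σ ∈ facesOf K, ‖normal K σ‖ = 1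
  face_subset_hyperplane : ∀ K, ∀ σ ∈ facesOf K,
    ∃ c : ℝ, ∀ x ∈ face σ, inner ℝ (normal K σ) x = c
  /-- Near almost every point of the face, the cell lies exactly on the side of the face opposite to
  the normal vector. -/
  normal_outward : ∀ K, ∀ σ ∈ facesOf K, ∀ᵐ x ∂(μHE[d - 1]).restrict (face σ),
    ∃ r > 0, ∀ y ∈ Metric.ball x r,
      (inner ℝ (normal K σ) (y - x) < 0 → y ∈ cell K) ∧
      (0 < inner ℝ (normal K σ) (y - x) → y ∉ cell K)
  face_subset_frontier : ∀ σ, (¬ ∃ K L, K ≠ L ∧ σ ∈ facesOf K ∧ σ ∈ facesOf L) →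
    face σ ⊆ frontier Ω

attribute [instance] PolyhedralMesh.fintypeCell PolyhedralMesh.fintypeFace

namespace PolyhedralMesh

variable {d : ℕ} {Ω : Set (Space d)} (M : PolyhedralMesh Ω)

/-- `σ = K|L`: the face `σ` is common to the two distinct cells `K` and `L`. -/
def Separates (σ : M.Face) (K L : M.Cell) : Prop :=
  K ≠ L ∧ σ ∈ M.facesOf K ∧ σ ∈ M.facesOf L

/-- `|K|`, the `d`-dimensional Lebesgue measure of a cell. -/
def cellVol (K : M.Cell) : ℝ := (volume (M.cell K)).toReal

/-- `|σ|`, the `(d-1)`-dimensional Lebesgue measure of a face. -/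
def faceArea (σ : M.Face) : ℝ := ((μHE[d - 1] : Measure (Space d)) (M.face σ)).toReal

/-- The size `h_M` of the mesh: the largest diameter of a cell. -/
def size : ℝ := ⨆ K : M.Cell, Metric.diam (M.cell K)

end PolyhedralMesh

/-- The additional data attached to a mesh: a point `x_K` in each cell, and a dual mesh, i.e. a
measurable partition `(D_σ)` of `Ω` indexed by the faces, with `D_σ ⊆ K ∪ L` (and `|D_σ| > 0`)
if `σ = K|L`. -/
structure DualMesh {d : ℕ} {Ω : Set (Space d)} (M : PolyhedralMesh Ω) where
  /-- the points `x_K` -/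
  pt : M.Cell → Space d
  /-- the dual cells `D_σ` -/
  dual : M.Face → Set (Space d)
  pt_mem : ∀ K, pt K ∈ M.cell K
  measurableSet_dual : ∀ σ, MeasurableSet (dual σ)
  pairwise_disjoint_dual : Pairwise fun σ τ => Disjoint (dual σ) (dual τ)
  iUnion_dual : ⋃ σ, dual σ = Ω
  dual_subset : ∀ σ K L, M.Separates σ K L → dual σ ⊆ M.cell K ∪ M.cell L
  volume_dual_pos : ∀ σ K L, M.Separates σ K L → 0 < volume (dual σ)

namespace DualMesh

variable {d : ℕ} {Ω : Set (Space d)} {M : PolyhedralMesh Ω} (D : DualMesh M)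

/-- `|D_σ|`. -/
def dualVol (σ : M.Face) : ℝ := (volume (D.dual σ)).toReal

/-- The regularity parameter attached to the discrete gradient:
`max |σ| |x_L - x_K| / |D_σ|` over the internal faces `σ = K|L`. -/
def thetaGrad : ℝ :=
  ⨆ p : {p : M.Face × M.Cell × M.Cell // M.Separates p.1 p.2.1 p.2.2},
    M.faceArea p.1.1 * dist (D.pt p.1.2.2) (D.pt p.1.2.1) / D.dualVol p.1.1

/-- The regularity parameter `max |D_σ| / |K|` over the cells `K` and the faces `σ` of `K`. -/
def theta : ℝ :=
  ⨆ p : {p : M.Cell × M.Face // p.2 ∈ M.facesOf p.1}, D.dualVol p.1.2 / M.cellVol p.1.1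

end DualMesh

/-- A time discretization `0 = t_0 < t_1 < ... < t_N = T` (the values `t n` for `n > N` are
irrelevant). -/
structure TimeGrid (T : ℝ) where
  N : ℕ
  t : ℕ → ℝ
  t_zero : t 0 = 0
  t_last : t N = T
  t_lt : ∀ n < N, t n < t (n + 1)

/-- The time step: the largest `t_{n+1} - t_n`. -/
def TimeGrid.step {T : ℝ} (G : TimeGrid T) : ℝ := ⨆ n : Fin G.N, (G.t (n + 1) - G.t n)

section Scheme

variable {d : ℕ} {Ω : Set (Space d)} {T : ℝ}

/-- The explicit finite volume scheme, with numerical fluxes `Fnum n σ = F_σ^n` and discrete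
unknowns `u n K = u_K^n`, started from the cell averages of `u₀`. -/
def IsFiniteVolumeSolution (M : PolyhedralMesh Ω) (G : TimeGrid T) (u₀ : Space d → ℝ)
    (Fnum : ℕ → M.Face → Space d) (u : ℕ → M.Cell → ℝ) : Prop :=
  (∀ K, u 0 K = (1 / M.cellVol K) * ∫ x in M.cell K, u₀ x) ∧
  ∀ n < G.N, ∀ K,
    M.cellVol K / (G.t (n + 1) - G.t n) * (u (n + 1) K - u n K)
      + ∑ σ ∈ M.facesOf K, M.faceArea σ * inner ℝ (Fnum n σ) (M.normal K σ) = 0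

/-- The piecewise constant function on `Ω × (0,T)` equal to `u_K^n` on `K × (t_n, t_{n+1}]`. -/
def discreteFunction (M : PolyhedralMesh Ω) (G : TimeGrid T) (u : ℕ → M.Cell → ℝ) :
    Space d × ℝ → ℝ := fun z =>
  ∑ n ∈ Finset.range G.N, ∑ K : M.Cell,
    (M.cell K ×ˢ Ioc (G.t n) (G.t (n + 1))).indicator (fun _ => u n K) z

end Scheme

/-- The Lebesgue measure on `Ω × (0,T)`. -/
def spaceTimeMeasure {d : ℕ} (Ω : Set (Space d)) (T : ℝ) : Measure (Space d × ℝ) :=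
  volume.restrict (Ω ×ˢ Ioo 0 T)

/-- Convergence in `L^1(μ)` of a sequence of functions of `L^1(μ)` to a function of `L^1(μ)`. -/
def TendstoInL1 {α H : Type*} [MeasurableSpace α] [NormedAddCommGroup H] (μ : Measure α)
    (f : ℕ → α → H) (g : α → H) : Prop :=
  (∀ m, MemLp (f m) 1 μ) ∧ MemLp g 1 μ ∧
    Tendsto (fun m => eLpNorm (fun z => f m z - g z) 1 μ) atTop (𝓝 0)

/-- Weak solutions on `Ω × [0,T)` of `∂_t u + div F(u) = 0`, `u(·,0) = u₀`. The test functions are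
the elements of `C_c^∞(Ω × [0,T))`, i.e. the restrictions to times `t ≥ 0` of the smooth functions
with compact support in `Ω × (-∞,T)`. -/
def IsWeakSolution {d : ℕ} (Ω : Set (Space d)) (T : ℝ) (F : ℝ → Space d) (u₀ : Space d → ℝ)
    (u : Space d × ℝ → ℝ) : Prop :=
  Integrable u (spaceTimeMeasure Ω T) ∧
  Integrable (fun z => F (u z)) (spaceTimeMeasure Ω T) ∧
  ∀ φ : Space d × ℝ → ℝ, ContDiff ℝ ∞ φ → HasCompactSupport φ → tsupport φ ⊆ Ω ×ˢ Iio T →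
    -∫ z, (u z * deriv (fun s => φ (z.1, s)) z.2
        + inner ℝ (F (u z)) (gradient (fun x => φ (x, z.2)) z.1)) ∂(spaceTimeMeasure Ω T)
      = ∫ x in Ω, u₀ x * φ (x, 0)

end

/-!
Multiply the scheme by `(t_{n+1} - t_n) φ(x_K, t_{n+1})` and sum over the space-time cells.
Summation by parts in time (`fluxSum_eq`) turns the discrete time derivative into the initial term
plus a Riemann sum for `∫∫ u^(m) ∂_t φ`, and these converge by the regularity of `φ`
(`tendsto_time_part`). It remains to show that the flux term converges to `-∫∫ F(ubar) · ∇φ`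
(`tendsto_fluxSum`).

The assumptions control `|σ| |x_L - x_K|` but not `|σ| h`, so that `φ(x_K)` cannot be compared with
the values of `φ` on the faces of `K`. Instead, the regularity is carried by a smooth field `ψ`
close to `F(ubar)` in `L^1`, and the numerical fluxes are compared with the mean values of `ψ` on
the faces.

* The difference is small (`abs_fluxSum_sub_average_le`). As the two normals of an internal face are
  opposite, the sum over the cells is a sum of differences `φ(x_K) - φ(x_L)` over the internal
  faces, bounded by `|D_σ|` times the flux errors (`abs_sum_flux_le`); the latter are bounded by
  `|u_K - u_L|` and by `|F(u_K) - ψ|`. Inserting a smooth function `w` close to `ubar` in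
  `|u_K - u_L|` leaves only the `L^1` distances of `u^(m)` to `w` and of `F(u^(m))` to `ψ`. The
  boundary faces do not contribute as soon as the mesh is finer than the distance of the support of
  `φ` to `∂Ω`.
* With the fluxes of `ψ`, the Gauss formula on each cell (`sum_faceArea_mul_inner_average`) yields a
  Riemann sum for `∫∫ φ div ψ` (`abs_fluxSum_average_sub_le`), which is `-∫∫ ∇φ · ψ`.

The Gauss formula is needed for cells that are only known through their frontier and normals. For
a direction `e`, almost every line of direction `e` crosses the frontier of `K` at finitely many
points, near each of which `K` is a half-space, and the indicator function of `K` jumps there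
by `± 1` according to the sign of `⟪n, e⟫`. Hence `1_K` is almost everywhere the signed sum of the
indicator functions of the shadows cast by the faces in the direction `e`
(`ae_sum_sign_shadow_eq`). The integral of `∂_e ψ` over a shadow is `|⟪n, e⟫| ∫_σ ψ`
(`setIntegral_shadow_fderiv`), by the disintegration of the Lebesgue measure along
the lines of direction `e` (`measurePreserving_add_smul_hyperplane`) and the fundamental theorem of
calculus.
-/

namespace LaxWendroff

/-! ### Disintegration of the Lebesgue measure along lines through a hyperplane -/

section Disintegration

variable {d : ℕ}

/-- The hyperplane `{x | ⟪n, x⟫ = c}`. -/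
def hyperplane (n : Space d) (c : ℝ) : Set (Space d) := {x | inner ℝ n x = c}

lemma measurableSet_hyperplane (n : Space d) (c : ℝ) : MeasurableSet (hyperplane n c) :=
  (isClosed_eq (by fun_prop) continuous_const).measurableSet

lemma measurePreserving_smul_add_orthogonal {n : Space d} (hn : ‖n‖ = 1) :
    MeasurePreserving (fun p : ℝ × ((ℝ ∙ n)ᗮ : Submodule ℝ (Space d)) => p.1 • n + (p.2 : Space d))
      (volume.prod volume) volume := by
  have h1 := ((ℝ ∙ n).measurePreserving_measurableEquivProd (0 : Space d)).symm
  rw [InnerProductSpace.euclideanHausdorffMeasure_eq_volume] at h1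
  have h2 := (LinearIsometryEquiv.toSpanUnitSingleton (𝕜 := ℝ) n hn).measurePreserving
  have h3 := h2.prod (MeasurePreserving.id (volume : Measure ((ℝ ∙ n)ᗮ : Submodule ℝ (Space d))))
  have h4 := h1.comp h3
  have heq : (fun p : ℝ × ((ℝ ∙ n)ᗮ : Submodule ℝ (Space d)) => p.1 • n + (p.2 : Space d)) =
      ((ℝ ∙ n).measurableEquivProd (0 : Space d)).symm ∘
        Prod.map (LinearIsometryEquiv.toSpanUnitSingleton (𝕜 := ℝ) n hn) id := by
    funext p
    rw [Function.comp_apply, Submodule.measurableEquivProd_symm_apply]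
    simp
  rw [heq]
  exact h4

lemma map_smul_add_orthogonal (hd : 1 ≤ d) {n : Space d} (hn : ‖n‖ = 1) (c : ℝ) :
    Measure.map (fun w : ((ℝ ∙ n)ᗮ : Submodule ℝ (Space d)) => c • n + (w : Space d)) volume
      = (μHE[d - 1]).restrict (hyperplane n c) := by
  have hn0 : n ≠ 0 := by rintro rfl; simp at hn
  have hiso : Isometry (fun w : ((ℝ ∙ n)ᗮ : Submodule ℝ (Space d)) => c • n + (w : Space d)) :=
    (isometry_add_left _).comp isometry_subtype_coe
  have hfr : Module.finrank ℝ ((ℝ ∙ n)ᗮ : Submodule ℝ (Space d)) = d - 1 := by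
    have : Fact (Module.finrank ℝ (Space d) = (d - 1) + 1) := ⟨by simp; omega⟩
    exact Submodule.finrank_orthogonal_span_singleton hn0
  have hvol : (μHE[d - 1] : Measure ((ℝ ∙ n)ᗮ : Submodule ℝ (Space d))) = volume := by
    rw [← hfr, InnerProductSpace.euclideanHausdorffMeasure_eq_volume]
  rw [← hvol, hiso.map_euclideanHausdorffMeasure]
  congr 1
  ext x
  simp only [mem_range, hyperplane, mem_ofPred_eq]
  constructor
  · rintro ⟨w, rfl⟩
    rw [inner_add_right, Submodule.mem_orthogonal_singleton_iff_inner_right.1 w.2,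
      inner_smul_right, real_inner_self_eq_norm_sq, hn]
    simp
  · intro hx
    refine ⟨⟨x - c • n, ?_⟩, by simp⟩
    rw [Submodule.mem_orthogonal_singleton_iff_inner_right, inner_sub_right, inner_smul_right,
      real_inner_self_eq_norm_sq, hn, hx]
    simp

lemma sFinite_restrict_hyperplane (hd : 1 ≤ d) {n : Space d} (hn : ‖n‖ = 1) (c : ℝ) :
    SFinite ((μHE[d - 1] : Measure (Space d)).restrict (hyperplane n c)) := by
  rw [← map_smul_add_orthogonal hd hn]
  infer_instance

/-- Lebesgue measure disintegrates along the lines of direction `e` through a hyperplane transverse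
to `e`, with density `|⟪n, e⟫|`: the shear along the hyperplane preserves the measure, so that only
the normal component of `e` counts. -/
lemma measurePreserving_add_smul_hyperplane (hd : 1 ≤ d) {n e : Space d} (hn : ‖n‖ = 1) (c : ℝ)
    (hne : inner ℝ n e ≠ 0) :
    MeasurePreserving (fun p : ℝ × Space d => p.2 + p.1 • e)
      ((ENNReal.ofReal |inner ℝ n e| • volume).prod ((μHE[d - 1]).restrict (hyperplane n c)))
      volume := by
  set a := inner ℝ n e with ha
  let W : Submodule ℝ (Space d) := (ℝ ∙ n)ᗮ
  have hW : e - a • n ∈ W := by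
    rw [Submodule.mem_orthogonal_singleton_iff_inner_right, inner_sub_right, inner_smul_right,
      real_inner_self_eq_norm_sq, hn]
    simp [ha]
  let e' : W := ⟨e - a • n, hW⟩
  have hf : MeasurePreserving (fun s : ℝ => c + s * a) (ENNReal.ofReal |a| • volume) volume := by
    have h1 : MeasurePreserving (fun s : ℝ => s * a) (ENNReal.ofReal |a| • volume) volume :=
      ⟨by fun_prop, by rw [Measure.map_smul]; exact Real.smul_map_volume_mul_right hne⟩
    exact (measurePreserving_add_left volume c).comp h1
  have hsk : MeasurePreserving (fun p : ℝ × W => (c + p.1 * a, p.2 + p.1 • e'))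
      ((ENNReal.ofReal |a| • volume).prod volume) (volume.prod volume) := by
    refine MeasurePreserving.skew_product (g := fun s w => w + s • e') hf ?_ ?_
    · change Measurable fun p : ℝ × W => p.2 + p.1 • e'
      fun_prop
    · exact Eventually.of_forall fun s => (measurePreserving_add_right volume (s • e')).map_eq
  have hcomp := (measurePreserving_smul_add_orthogonal hn).comp hsk
  have := sFinite_restrict_hyperplane hd hn c
  have hbase : MeasurePreserving (fun w : W => c • n + (w : Space d)) volume
      ((μHE[d - 1]).restrict (hyperplane n c)) :=
    ⟨by fun_prop, map_smul_add_orthogonal hd hn c⟩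
  have hid := (MeasurePreserving.id (ENNReal.ofReal |a| • (volume : Measure ℝ))).prod hbase
  refine ⟨by fun_prop, ?_⟩
  rw [← hid.map_eq, Measure.map_map (by fun_prop) hid.measurable, ← hcomp.map_eq]
  congr 1
  funext p
  simp only [Function.comp, Prod.map, id, e', Submodule.coe_add, Submodule.coe_smul]
  module

/-- The set of the points `x` of the form `z + s • e` with `z ∈ A` and `s < 0`. -/
def shadow (e : Space d) (A : Set (Space d)) : Set (Space d) := {x | ∃ s < (0 : ℝ), x - s • e ∈ A}

lemma sub_smul_mem_hyperplane {n e x : Space d} {c s : ℝ} (hne : inner ℝ n e ≠ 0)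
    (h : x - s • e ∈ hyperplane n c) : s = (inner ℝ n x - c) / inner ℝ n e := by
  simp only [hyperplane, mem_ofPred_eq, inner_sub_right, inner_smul_right] at h
  rw [eq_div_iff hne]
  linarith

lemma measurableSet_shadow {n e : Space d} {c : ℝ} (hne : inner ℝ n e ≠ 0) {A : Set (Space d)}
    (hA : MeasurableSet A) (hAH : A ⊆ hyperplane n c) : MeasurableSet (shadow e A) := by
  have : shadow e A = {x | (inner ℝ n x - c) / inner ℝ n e < 0} ∩
      (fun x => x - ((inner ℝ n x - c) / inner ℝ n e) • e) ⁻¹' A := by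
    ext x
    constructor
    · rintro ⟨s, hs, hx⟩
      rw [sub_smul_mem_hyperplane hne (hAH hx)] at hs hx
      exact ⟨hs, hx⟩
    · rintro ⟨hs, hx⟩
      exact ⟨_, hs, hx⟩
  rw [this]
  exact (measurableSet_lt (by fun_prop) (by fun_prop)).inter
    (hA.preimage (by fun_prop))

/-- Almost every line of direction `e` avoids a negligible subset of a hyperplane transverse
to `e`. -/
lemma ae_forall_sub_smul_notMem (hd : 1 ≤ d) {n e : Space d} (hn : ‖n‖ = 1) {c : ℝ}
    (hne : inner ℝ n e ≠ 0) {A : Set (Space d)} (hAH : A ⊆ hyperplane n c)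
    (hA : μHE[d - 1] A = 0) : ∀ᵐ x : Space d, ∀ s : ℝ, x - s • e ∉ A := by
  have hsf := sFinite_restrict_hyperplane hd hn c
  have hmp := measurePreserving_add_smul_hyperplane hd hn c hne
  obtain ⟨B, hAB, hBm, hB0⟩ := exists_measurable_superset_of_null hA
  set f : Space d → Space d := fun x => x - ((inner ℝ n x - c) / inner ℝ n e) • e with hf
  have hfm : Measurable f := by fun_prop
  have h1 : volume (f ⁻¹' B) = 0 := by
    rw [← hmp.measure_preimage (hBm.preimage hfm).nullMeasurableSet]
    have h2 : ∀ᵐ p ∂((ENNReal.ofReal |inner ℝ n e| • (volume : Measure ℝ)).prod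
        ((μHE[d - 1]).restrict (hyperplane n c))), p.2 ∈ hyperplane n c ∧ p.2 ∉ B := by
      have h3 : ∀ᵐ z ∂((μHE[d - 1] : Measure (Space d)).restrict (hyperplane n c)),
          z ∈ hyperplane n c ∧ z ∉ B := by
        refine (ae_restrict_mem (measurableSet_hyperplane n c)).and ?_
        refine ae_restrict_of_ae ?_
        rw [ae_iff]
        simpa using hB0
      exact Measure.quasiMeasurePreserving_snd.ae h3
    refine measure_mono_null ?_ (ae_iff.1 h2)
    rintro p hp ⟨hp1, hp2⟩
    apply hp2
    have : f (p.2 + p.1 • e) = p.2 := by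
      simp only [hyperplane, mem_ofPred_eq] at hp1
      simp only [hf, inner_add_right, inner_smul_right, hp1]
      rw [add_sub_cancel_left, mul_div_cancel_right₀ _ hne, add_sub_cancel_right]
    rw [← this]
    exact hp
  filter_upwards [measure_eq_zero_iff_ae_notMem.1 h1] with x hx s hs
  apply hx
  rw [mem_preimage, hf]
  simp only
  rw [← sub_smul_mem_hyperplane hne (hAH hs)]
  exact hAB hs

lemma ae_notMem_hyperplane {n : Space d} (hn : ‖n‖ = 1) (c : ℝ) :
    ∀ᵐ x : Space d, x ∉ hyperplane n c := by
  have hn0 : n ≠ 0 := by rintro rfl; simp at hn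
  let S : AffineSubspace ℝ (Space d) := AffineSubspace.mk' (c • n) (ℝ ∙ n)ᗮ
  have hS : (S : Set (Space d)) = hyperplane n c := by
    ext x
    simp [S, AffineSubspace.mem_mk', Submodule.mem_orthogonal_singleton_iff_inner_right,
      inner_sub_right, inner_smul_right, hn, hyperplane, sub_eq_zero]
  have hS' : S ≠ ⊤ := by
    intro h
    have : (c + 1) • n ∈ (S : Set (Space d)) := by rw [h]; trivial
    rw [hS] at this
    simp [hyperplane, inner_smul_right, hn] at this
  have := Measure.addHaar_affineSubspace volume S hS'
  rw [hS] at this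
  exact measure_eq_zero_iff_ae_notMem.1 this

/-- Fubini's theorem on a shadow. -/
lemma setIntegral_shadow (hd : 1 ≤ d) {n e : Space d} (hn : ‖n‖ = 1) {c : ℝ}
    (hne : inner ℝ n e ≠ 0) {A : Set (Space d)} (hAm : MeasurableSet A)
    (hAH : A ⊆ hyperplane n c) {g : Space d → ℝ} (hg : Integrable g) :
    ∫ x in shadow e A, g x
      = |inner ℝ n e| * ∫ z in A, (∫ s in Iic (0 : ℝ), g (z + s • e)) ∂μHE[d - 1] := by
  have hsf := sFinite_restrict_hyperplane hd hn c
  have hmp := measurePreserving_add_smul_hyperplane hd hn c hne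
  have hSm := measurableSet_shadow hne hAm hAH
  have hgi := hg.indicator hSm
  rw [← integral_indicator hSm]
  conv_lhs => rw [← hmp.map_eq]
  rw [← hmp.map_eq] at hgi
  have hgc : Integrable (fun p : ℝ × Space d => (shadow e A).indicator g (p.2 + p.1 • e))
      ((ENNReal.ofReal |inner ℝ n e| • volume).prod ((μHE[d - 1]).restrict (hyperplane n c))) :=
    hgi.comp_measurable hmp.measurable
  rw [integral_map hmp.measurable.aemeasurable hgi.1, integral_prod_symm _ hgc,
    ← integral_const_mul, ← integral_indicator hAm,
    ← integral_indicator (measurableSet_hyperplane n c)]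
  congr 1
  funext z
  by_cases hz : z ∈ hyperplane n c
  · rw [indicator_of_mem hz, integral_smul_measure, ENNReal.toReal_ofReal (abs_nonneg _),
      smul_eq_mul]
    have hiff : ∀ s : ℝ, z + s • e ∈ shadow e A ↔ s < 0 ∧ z ∈ A := by
      intro s
      constructor
      · rintro ⟨s', hs', h⟩
        have h1 := sub_smul_mem_hyperplane hne (hAH h)
        simp only [hyperplane, mem_ofPred_eq] at hz
        rw [inner_add_right, inner_smul_right, hz, add_sub_cancel_left,
          mul_div_cancel_right₀ _ hne] at h1
        subst h1
        exact ⟨hs', by simpa using h⟩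
      · rintro ⟨hs, hzA⟩
        exact ⟨s, hs, by simpa using hzA⟩
    by_cases hzA : z ∈ A
    · rw [indicator_of_mem hzA, integral_Iic_eq_integral_Iio,
        ← integral_indicator measurableSet_Iio]
      congr 2
      funext s
      simp only [indicator, hiff, hzA, and_true, mem_Iio]
    · rw [indicator_of_notMem hzA]
      have : ∀ s : ℝ, (shadow e A).indicator g (z + s • e) = 0 := fun s =>
        indicator_of_notMem (fun h => hzA ((hiff s).1 h).2) _
      simp [this]
  · rw [indicator_of_notMem hz, indicator_of_notMem (fun h => hz (hAH h))]

/-- By the fundamental theorem of calculus on the half-lines `{z + s • e | s ≤ 0}`, `z ∈ A`. -/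
lemma setIntegral_shadow_fderiv (hd : 1 ≤ d) {n e : Space d} (hn : ‖n‖ = 1) {c : ℝ}
    (hne : inner ℝ n e ≠ 0) {A : Set (Space d)} (hAm : MeasurableSet A)
    (hAH : A ⊆ hyperplane n c) {ψ : Space d → ℝ} (hψ : ContDiff ℝ 1 ψ) (hψc : HasCompactSupport ψ) :
    ∫ x in shadow e A, fderiv ℝ ψ x e = |inner ℝ n e| * ∫ z in A, ψ z ∂μHE[d - 1] := by
  have he : e ≠ 0 := by rintro rfl; simp at hne
  have hcont : Continuous fun x => fderiv ℝ ψ x e :=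
    (hψ.continuous_fderiv one_ne_zero).clm_apply continuous_const
  have hcs : HasCompactSupport fun x => fderiv ℝ ψ x e := hψc.fderiv_apply ℝ e
  rw [setIntegral_shadow hd hn hne hAm hAH (hcont.integrable_of_hasCompactSupport hcs)]
  congr 2
  funext z
  have hemb : IsClosedEmbedding fun s : ℝ => z + s • e :=
    (Homeomorph.addLeft z).isClosedEmbedding.comp (isClosedEmbedding_smul_left he)
  have hline : ContDiff ℝ 1 fun s : ℝ => ψ (z + s • e) := hψ.comp (by fun_prop)
  have hder : ∀ s : ℝ, deriv (fun s : ℝ => ψ (z + s • e)) s = fderiv ℝ ψ (z + s • e) e := by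
    intro s
    have h1 : HasDerivAt (fun s : ℝ => z + s • e) e s := by
      simpa using ((hasDerivAt_id s).smul_const e).const_add z
    exact (((hψ.differentiable one_ne_zero) _).hasFDerivAt.comp_hasDerivAt s h1).deriv
  have := HasCompactSupport.integral_Iic_deriv_eq hline (hψc.comp_isClosedEmbedding hemb) 0
  simp only [hder] at this
  simpa using this

end Disintegration

/-! ### The Gauss formula on a polyhedral cell -/

section Gauss

/-- A function on the line which is constant on a punctured neighbourhood of each point takes the
same value on all of them, by connectedness. -/
lemma exists_forall_eventually_eq_of_punctured {α : Type*} {g : ℝ → α}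
    (h : ∀ s, ∃ c, ∀ᶠ t in 𝓝[≠] s, g t = c) : ∃ c, ∀ s, ∀ᶠ t in 𝓝[≠] s, g t = c := by
  choose G hG using h
  have hloc : IsLocallyConstant G := by
    rw [IsLocallyConstant.iff_eventually_eq]
    intro s
    rw [← nhdsNE_sup_pure, eventually_sup]
    refine ⟨?_, by simp⟩
    filter_upwards [eventually_eventually_nhdsWithin.2 (hG s), self_mem_nhdsWithin] with t ht hts
    rw [nhdsWithin_eq_nhds.2 (isOpen_compl_singleton.mem_nhds hts)] at ht
    obtain ⟨r, hr1, hr2⟩ := ((hG t).and (ht.filter_mono nhdsWithin_le_nhds)).exists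
    rw [← hr1, hr2]
  exact ⟨G 0, fun s => by rw [hloc.apply_eq_of_preconnectedSpace 0 s]; exact hG s⟩

lemma eventually_exists_lt_iff {S : Set ℝ} (hS : S.Subsingleton) {s₀ : ℝ} (hs₀ : s₀ ∉ S) :
    ∀ᶠ t in 𝓝 s₀, (∃ s ∈ S, s < t) ↔ ∃ s ∈ S, s < s₀ := by
  obtain rfl | ⟨a, rfl⟩ := hS.eq_empty_or_singleton
  · simp
  · simp only [mem_singleton_iff, exists_eq_left] at hs₀ ⊢
    rcases lt_or_gt_of_ne hs₀ with h | h
    · filter_upwards [eventually_lt_nhds h] with t ht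
      exact ⟨fun h' => absurd ht h'.not_gt, fun h' => absurd h h'.not_gt⟩
    · filter_upwards [eventually_gt_nhds h] with t ht
      exact ⟨fun _ => h, fun _ => ht⟩

variable {d : ℕ} {Ω : Set (Space d)} (M : PolyhedralMesh Ω)

/-- The set of the points of the face `σ` near which the cell `K` is not the half-space opposite to
the normal vector. -/
def badPoints (K : M.Cell) (σ : M.Face) : Set (Space d) :=
  {x ∈ M.face σ | ¬ ∃ r > 0, ∀ y ∈ Metric.ball x r,
      (inner ℝ (M.normal K σ) (y - x) < 0 → y ∈ M.cell K) ∧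
      (0 < inner ℝ (M.normal K σ) (y - x) → y ∉ M.cell K)}

lemma measure_badPoints {K : M.Cell} {σ : M.Face} (hσ : σ ∈ M.facesOf K) :
    μHE[d - 1] (badPoints M K σ) = 0 := by
  have h := M.normal_outward K σ hσ
  rw [ae_restrict_iff' (M.measurableSet_face σ), ae_iff] at h
  refine measure_mono_null ?_ h
  rintro x ⟨hx1, hx2⟩ h'
  exact hx2 (h' hx1)

open Classical in
/-- Along a line of direction `e` in general position, the indicator function of a cell jumps at the
faces, upwards or downwards according to the sign of `⟪n, e⟫`; summing the jumps before a point
gives the value at this point. -/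
lemma sum_sign_shadow_eq_of_generic {K : M.Cell} (hKb : Bornology.IsBounded (M.cell K))
    {e x : Space d} (he : e ≠ 0)
    (h1 : ∀ σ ∈ M.facesOf K, ∀ z ∈ M.face σ, inner ℝ (M.normal K σ) x ≠ inner ℝ (M.normal K σ) z)
    (h2 : ∀ σ ∈ M.facesOf K, inner ℝ (M.normal K σ) e ≠ 0 → ∀ s : ℝ, x - s • e ∉ badPoints M K σ)
    (h3 : ∀ σ ∈ M.facesOf K, ∀ τ ∈ M.facesOf K, σ ≠ τ → inner ℝ (M.normal K σ) e ≠ 0 →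
      ∀ s : ℝ, x - s • e ∉ M.face σ ∩ M.face τ) :
    ∑ σ ∈ M.facesOf K, SignType.sign (inner ℝ (M.normal K σ) e) *
        (shadow e (M.face σ)).indicator (fun _ => (1 : ℝ)) x
      = (M.cell K).indicator (fun _ => (1 : ℝ)) x := by
  let S : M.Face → Set ℝ := fun σ => {s | x - s • e ∈ M.face σ}
  have htrans : ∀ σ ∈ M.facesOf K, ∀ s ∈ S σ, inner ℝ (M.normal K σ) e ≠ (0 : ℝ) := by
    intro σ hσ s hs h0
    refine h1 σ hσ _ hs ?_
    rw [inner_sub_right, inner_smul_right, h0]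
    simp
  have hSsub : ∀ σ ∈ M.facesOf K, (S σ).Subsingleton := by
    intro σ hσ s hs t ht
    obtain ⟨c, hc⟩ := M.face_subset_hyperplane K σ hσ
    have hne := htrans σ hσ s hs
    rw [sub_smul_mem_hyperplane (c := c) hne (hc _ hs),
      sub_smul_mem_hyperplane (c := c) hne (hc _ ht)]
  -- `f` is the indicator function along the line, `st σ` the jump at the crossing of the face `σ`;
  -- their difference `g` turns out to be constant off the crossings
  let f : ℝ → ℝ := fun s => (M.cell K).indicator (fun _ => (1 : ℝ)) (x - s • e)
  let st : M.Face → ℝ → ℝ := fun σ s =>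
    SignType.sign (inner ℝ (M.normal K σ) e) * if ∃ s' ∈ S σ, s' < s then 1 else 0
  let g : ℝ → ℝ := fun s => f s - ∑ σ ∈ M.facesOf K, st σ s
  have hline : Continuous fun s : ℝ => x - s • e := by fun_prop
  have hst : ∀ σ ∈ M.facesOf K, ∀ s ∉ S σ, ∀ᶠ t in 𝓝 s, st σ t = st σ s := by
    intro σ hσ s hs
    filter_upwards [eventually_exists_lt_iff (hSsub σ hσ) hs] with t ht
    simp only [st, ht]
  have hf : ∀ s, x - s • e ∉ frontier (M.cell K) → ∀ᶠ t in 𝓝 s, f t = f s := by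
    intro s hs
    by_cases hin : x - s • e ∈ interior (M.cell K)
    · have := hline.continuousAt.eventually (isOpen_interior.mem_nhds hin)
      filter_upwards [this] with t ht
      simp only [f]
      rw [indicator_of_mem (interior_subset ht), indicator_of_mem (interior_subset hin)]
    · have hout : x - s • e ∈ (closure (M.cell K))ᶜ := fun h => hs ⟨h, hin⟩
      have := hline.continuousAt.eventually (isClosed_closure.isOpen_compl.mem_nhds hout)
      filter_upwards [this] with t ht
      simp only [f]
      rw [indicator_of_notMem fun h => ht (subset_closure h),
        indicator_of_notMem fun h => hout (subset_closure h)]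
  have hoff : ∀ s, x - s • e ∉ frontier (M.cell K) → ∀ᶠ t in 𝓝 s, g t = g s := by
    intro s hs
    have hall : ∀ᶠ t in 𝓝 s, ∀ σ ∈ M.facesOf K, st σ t = st σ s := by
      rw [Finset.eventually_all]
      intro σ hσ
      refine hst σ hσ s fun hs' => hs ?_
      rw [M.frontier_cell K]
      exact mem_biUnion (Finset.mem_coe.2 hσ) hs'
    filter_upwards [hf s hs, hall] with t h1 h2
    simp only [g, h1, Finset.sum_congr rfl h2]
  have hpunct : ∀ s, ∃ c, ∀ᶠ t in 𝓝[≠] s, g t = c := by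
    intro s
    by_cases hs : x - s • e ∈ frontier (M.cell K)
    · rw [M.frontier_cell K] at hs
      simp only [mem_iUnion, exists_prop] at hs
      obtain ⟨σ, hσ, hsσ⟩ := hs
      have hne := htrans σ hσ s hsσ
      have hgood : ∃ r > 0, ∀ y ∈ Metric.ball (x - s • e) r,
          (inner ℝ (M.normal K σ) (y - (x - s • e)) < 0 → y ∈ M.cell K) ∧
          (0 < inner ℝ (M.normal K σ) (y - (x - s • e)) → y ∉ M.cell K) := by
        by_contra hcon
        exact h2 σ hσ hne s ⟨hsσ, hcon⟩
      obtain ⟨r, hr, hball⟩ := hgood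
      have hothers : ∀ᶠ t in 𝓝 s, ∀ τ ∈ (M.facesOf K).erase σ, st τ t = st τ s := by
        rw [Finset.eventually_all]
        intro τ hτ
        rw [Finset.mem_erase] at hτ
        exact hst τ hτ.2 s fun hs' => h3 σ hσ τ hτ.2 (Ne.symm hτ.1) hne s ⟨hsσ, hs'⟩
      have hin : ∀ᶠ t in 𝓝 s, x - t • e ∈ Metric.ball (x - s • e) r :=
        hline.continuousAt.eventually (Metric.ball_mem_nhds _ hr)
      refine ⟨(if inner ℝ (M.normal K σ) e < 0 then 1 else 0) -
        ∑ τ ∈ (M.facesOf K).erase σ, st τ s, ?_⟩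
      filter_upwards [hothers.filter_mono nhdsWithin_le_nhds, hin.filter_mono nhdsWithin_le_nhds,
        self_mem_nhdsWithin] with t ht1 ht2 ht3
      have hts : t ≠ s := ht3
      have hiff : (∃ s' ∈ S σ, s' < t) ↔ s < t :=
        ⟨fun ⟨s', hs', h⟩ => by rwa [hSsub σ hσ hsσ hs'], fun h => ⟨s, hsσ, h⟩⟩
      have hb := hball _ ht2
      have hinner : inner ℝ (M.normal K σ) (x - t • e - (x - s • e))
          = (s - t) * inner ℝ (M.normal K σ) e := by
        rw [show x - t • e - (x - s • e) = (s - t) • e by module, inner_smul_right]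
      rw [hinner] at hb
      have hsum : g t = (f t - st σ t) - ∑ τ ∈ (M.facesOf K).erase σ, st τ s := by
        simp only [g]
        rw [← Finset.add_sum_erase _ _ hσ, Finset.sum_congr rfl ht1]
        ring
      rw [hsum]
      congr 1
      simp only [f, st, hiff]
      rcases lt_or_gt_of_ne hne with ha | ha <;> rcases lt_or_gt_of_ne hts with hlt | hlt
      · rw [indicator_of_mem (hb.1 (mul_neg_of_pos_of_neg (by linarith) ha))]
        simp [ha, hlt.not_gt]
      · rw [indicator_of_notMem (hb.2 (mul_pos_of_neg_of_neg (by linarith) ha))]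
        simp [ha, hlt]
      · rw [indicator_of_notMem (hb.2 (mul_pos (by linarith) ha))]
        simp [ha.not_gt, hlt.not_gt]
      · rw [indicator_of_mem (hb.1 (mul_neg_of_neg_of_pos (by linarith) ha))]
        simp [ha, ha.not_gt, hlt]
    · exact ⟨g s, (hoff s hs).filter_mono nhdsWithin_le_nhds⟩
  obtain ⟨c, hc⟩ := exists_forall_eventually_eq_of_punctured hpunct
  have hval : ∀ s, x - s • e ∉ frontier (M.cell K) → g s = c := by
    intro s hs
    obtain ⟨t, ht1, ht2⟩ := (((hoff s hs).filter_mono nhdsWithin_le_nhds).and (hc s)).exists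
    rw [← ht1, ht2]
  -- far away in the direction `e` there is neither a point of the cell nor a face
  have hKc : Bornology.IsBounded (closure (M.cell K)) := hKb.closure
  have hfar : ∀ᶠ s : ℝ in atBot, x - s • e ∉ closure (M.cell K) := by
    obtain ⟨R, hR⟩ := hKc.exists_norm_le
    filter_upwards [eventually_lt_atBot (-((R + ‖x‖) / ‖e‖)), eventually_lt_atBot 0]
      with s hs hs0 hmem
    have h1 := hR _ hmem
    have h2 : ‖s • e‖ ≤ ‖x - s • e‖ + ‖x‖ := by
      have := norm_sub_le x (x - s • e)
      rw [sub_sub_cancel] at this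
      linarith
    rw [norm_smul, Real.norm_eq_abs, abs_of_neg hs0] at h2
    have h3 : (R + ‖x‖) / ‖e‖ < -s := by linarith
    rw [div_lt_iff₀ (norm_pos_iff.2 he)] at h3
    linarith
  obtain ⟨s₁, hs₁⟩ := eventually_atBot.1 hfar
  have hfc : ∀ σ ∈ M.facesOf K, M.face σ ⊆ closure (M.cell K) := by
    intro σ hσ y hy
    apply frontier_subset_closure
    rw [M.frontier_cell K]
    exact mem_biUnion (Finset.mem_coe.2 hσ) hy
  have hc0 : c = 0 := by
    rw [← hval s₁ fun h => hs₁ s₁ le_rfl (frontier_subset_closure h)]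
    have hf0 : f s₁ = 0 := indicator_of_notMem (fun h => hs₁ s₁ le_rfl (subset_closure h)) _
    have hst0 : ∀ σ ∈ M.facesOf K, st σ s₁ = 0 := by
      intro σ hσ
      simp only [st]
      rw [if_neg, mul_zero]
      rintro ⟨s', hs', hlt⟩
      exact hs₁ s' hlt.le (hfc σ hσ hs')
    simp only [g, hf0, Finset.sum_eq_zero hst0, sub_zero]
  have hx : x - (0 : ℝ) • e ∉ frontier (M.cell K) := by
    rw [M.frontier_cell K, zero_smul, sub_zero]
    simp only [mem_iUnion, not_exists]
    intro σ hσ hx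
    exact h1 σ hσ x hx rfl
  have h0 := hval 0 hx
  rw [hc0] at h0
  simp only [g, f, st, zero_smul, sub_zero, sub_eq_zero] at h0
  rw [h0]
  refine Finset.sum_congr rfl fun σ _ => ?_
  congr 1
  simp only [indicator, shadow, mem_ofPred_eq, S]
  refine if_congr ?_ rfl rfl
  exact ⟨fun ⟨s, a, b⟩ => ⟨s, b, a⟩, fun ⟨s, a, b⟩ => ⟨s, b, a⟩⟩

lemma exists_face_subset_hyperplane {K : M.Cell} {σ : M.Face} (hσ : σ ∈ M.facesOf K) :
    ∃ c, M.face σ ⊆ hyperplane (M.normal K σ) c :=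
  (M.face_subset_hyperplane K σ hσ).imp fun _ hc x hx => hc x hx

lemma ae_sum_sign_shadow_eq (hd : 1 ≤ d) {K : M.Cell} (hKb : Bornology.IsBounded (M.cell K))
    {e : Space d} (he : e ≠ 0) :
    ∀ᵐ x : Space d, ∑ σ ∈ M.facesOf K, SignType.sign (inner ℝ (M.normal K σ) e) *
        (shadow e (M.face σ)).indicator (fun _ => (1 : ℝ)) x
      = (M.cell K).indicator (fun _ => (1 : ℝ)) x := by
  have h1 : ∀ᵐ x : Space d, ∀ σ ∈ M.facesOf K, ∀ z ∈ M.face σ,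
      inner ℝ (M.normal K σ) x ≠ inner ℝ (M.normal K σ) z := by
    rw [Finset.eventually_all]
    intro σ hσ
    obtain ⟨c, hc⟩ := exists_face_subset_hyperplane M hσ
    filter_upwards [ae_notMem_hyperplane (M.norm_normal K σ hσ) c] with x hx z hz h
    exact hx (h.trans (hc hz))
  have h2 : ∀ᵐ x : Space d, ∀ σ ∈ M.facesOf K, inner ℝ (M.normal K σ) e ≠ 0 →
      ∀ s : ℝ, x - s • e ∉ badPoints M K σ := by
    rw [Finset.eventually_all]
    intro σ hσ
    obtain ⟨c, hc⟩ := exists_face_subset_hyperplane M hσ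
    by_cases hne : inner ℝ (M.normal K σ) e = 0
    · exact Eventually.of_forall fun x h => absurd hne h
    filter_upwards [ae_forall_sub_smul_notMem hd (M.norm_normal K σ hσ) hne
      ((sep_subset _ _).trans hc) (measure_badPoints M hσ)] with x hx _ using hx
  have h3 : ∀ᵐ x : Space d, ∀ σ ∈ M.facesOf K, ∀ τ ∈ M.facesOf K, σ ≠ τ →
      inner ℝ (M.normal K σ) e ≠ 0 → ∀ s : ℝ, x - s • e ∉ M.face σ ∩ M.face τ := by
    rw [Finset.eventually_all]
    intro σ hσ
    rw [Finset.eventually_all]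
    intro τ hτ
    obtain ⟨c, hc⟩ := exists_face_subset_hyperplane M hσ
    by_cases hne : inner ℝ (M.normal K σ) e = 0
    · exact Eventually.of_forall fun x _ h => absurd hne h
    by_cases hστ : σ = τ
    · exact Eventually.of_forall fun x h => absurd hστ h
    filter_upwards [ae_forall_sub_smul_notMem hd (M.norm_normal K σ hσ) hne
      (inter_subset_left.trans hc) (M.aedisjoint_face K σ hσ τ hτ hστ)] with x hx _ _ using hx
  filter_upwards [h1, h2, h3] with x hx1 hx2 hx3
  exact sum_sign_shadow_eq_of_generic M hKb he hx1 hx2 hx3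

/-- The Gauss formula on a cell, for a directional derivative. -/
theorem sum_inner_normal_mul_setIntegral_face (hd : 1 ≤ d) {K : M.Cell}
    (hKb : Bornology.IsBounded (M.cell K)) (e : Space d) {ψ : Space d → ℝ} (hψ : ContDiff ℝ 1 ψ)
    (hψc : HasCompactSupport ψ) :
    ∑ σ ∈ M.facesOf K, inner ℝ (M.normal K σ) e * ∫ z in M.face σ, ψ z ∂μHE[d - 1]
      = ∫ x in M.cell K, fderiv ℝ ψ x e := by
  by_cases he : e = 0
  · simp [he]
  have hcont : Continuous fun x => fderiv ℝ ψ x e :=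
    (hψ.continuous_fderiv one_ne_zero).clm_apply continuous_const
  have hint : Integrable fun x => fderiv ℝ ψ x e :=
    hcont.integrable_of_hasCompactSupport (hψc.fderiv_apply ℝ e)
  have hterm : ∀ σ ∈ M.facesOf K, inner ℝ (M.normal K σ) e * ∫ z in M.face σ, ψ z ∂μHE[d - 1]
      = ∫ x, (SignType.sign (inner ℝ (M.normal K σ) e) *
        (shadow e (M.face σ)).indicator (fun _ => (1 : ℝ)) x) * fderiv ℝ ψ x e ∧
      Integrable fun x => (SignType.sign (inner ℝ (M.normal K σ) e) *
        (shadow e (M.face σ)).indicator (fun _ => (1 : ℝ)) x) * fderiv ℝ ψ x e := by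
    intro σ hσ
    obtain ⟨c, hc⟩ := exists_face_subset_hyperplane M hσ
    by_cases hne : inner ℝ (M.normal K σ) e = 0
    · simp [hne]
    have hSm := measurableSet_shadow hne (M.measurableSet_face σ) hc
    have hfun : (fun x => (SignType.sign (inner ℝ (M.normal K σ) e) *
        (shadow e (M.face σ)).indicator (fun _ => (1 : ℝ)) x) * fderiv ℝ ψ x e) =
        fun x => (SignType.sign (inner ℝ (M.normal K σ) e) : ℝ) *
          (shadow e (M.face σ)).indicator (fun x => fderiv ℝ ψ x e) x := by
      funext x
      by_cases hx : x ∈ shadow e (M.face σ) <;> simp [hx]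
    rw [hfun]
    refine ⟨?_, (hint.indicator hSm).const_mul _⟩
    rw [integral_const_mul, integral_indicator hSm,
      setIntegral_shadow_fderiv hd (M.norm_normal K σ hσ) hne (M.measurableSet_face σ) hc hψ hψc,
      ← mul_assoc, sign_mul_abs]
  rw [Finset.sum_congr rfl fun σ hσ => (hterm σ hσ).1,
    ← integral_finsetSum _ fun σ hσ => (hterm σ hσ).2,
    ← integral_indicator (M.measurableSet_cell K)]
  refine integral_congr_ae ?_
  filter_upwards [ae_sum_sign_shadow_eq M hd hKb he] with x hx
  rw [← Finset.sum_mul, hx]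
  by_cases hxK : x ∈ M.cell K <;> simp [hxK]

end Gauss

/-! ### Faces, cells and dual cells of a mesh -/

section Geometry

variable {d : ℕ}

lemma measure_lt_top_of_subset_hyperplane (hd : 1 ≤ d) {n : Space d} (hn : ‖n‖ = 1) {c : ℝ}
    {A : Set (Space d)} (hA : A ⊆ hyperplane n c) (hAb : Bornology.IsBounded A) :
    μHE[d - 1] A < ⊤ := by
  have hnn : inner ℝ n n ≠ (0 : ℝ) := by rw [real_inner_self_eq_norm_sq, hn]; norm_num
  have hsf := sFinite_restrict_hyperplane hd hn c
  have hmp := measurePreserving_add_smul_hyperplane hd hn c hnn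
  obtain ⟨R, hR⟩ := hAb.exists_norm_le
  have h1 : volume (Metric.closedBall (0 : Space d) (R + 1)) < ⊤ := measure_closedBall_lt_top
  rw [← hmp.measure_preimage Metric.isClosed_closedBall.measurableSet.nullMeasurableSet] at h1
  have hsub : Icc (0 : ℝ) 1 ×ˢ A ⊆
      (fun p : ℝ × Space d => p.2 + p.1 • n) ⁻¹' Metric.closedBall 0 (R + 1) := by
    rintro ⟨s, z⟩ ⟨hs, hz⟩
    simp only [mem_preimage, mem_closedBall_zero_iff]
    refine (norm_add_le _ _).trans (add_le_add (hR z hz) ?_)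
    rw [norm_smul, hn, mul_one, Real.norm_eq_abs, abs_le]
    exact ⟨by linarith [hs.1], hs.2⟩
  have h2 := (measure_mono hsub).trans_lt h1
  rw [Measure.prod_prod, Measure.restrict_apply' (measurableSet_hyperplane n c),
    inter_eq_left.2 hA, real_inner_self_eq_norm_sq, hn] at h2
  simpa using h2

variable {Ω : Set (Space d)} (M : PolyhedralMesh Ω)

lemma cell_subset (K : M.Cell) : M.cell K ⊆ Ω :=
  (subset_iUnion M.cell K).trans M.iUnion_cell.subset

lemma face_subset_frontier_cell {K : M.Cell} {σ : M.Face} (hσ : σ ∈ M.facesOf K) :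
    M.face σ ⊆ frontier (M.cell K) := by
  rw [M.frontier_cell K]
  exact fun y hy => mem_biUnion (Finset.mem_coe.2 hσ) hy

lemma face_subset_closure_cell {K : M.Cell} {σ : M.Face} (hσ : σ ∈ M.facesOf K) :
    M.face σ ⊆ closure (M.cell K) :=
  (face_subset_frontier_cell M hσ).trans frontier_subset_closure

lemma isBounded_face (hΩb : Bornology.IsBounded Ω) (σ : M.Face) :
    Bornology.IsBounded (M.face σ) := by
  obtain ⟨K, hK⟩ := M.exists_mem_facesOf σ
  exact (hΩb.subset (cell_subset M K)).closure.subset (face_subset_closure_cell M hK)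

lemma measure_face_lt_top (hd : 1 ≤ d) (hΩb : Bornology.IsBounded Ω) (σ : M.Face) :
    μHE[d - 1] (M.face σ) < ⊤ := by
  obtain ⟨K, hK⟩ := M.exists_mem_facesOf σ
  obtain ⟨c, hc⟩ := exists_face_subset_hyperplane M hK
  exact measure_lt_top_of_subset_hyperplane hd (M.norm_normal K σ hK) hc (isBounded_face M hΩb σ)

lemma volume_cell_lt_top (hΩb : Bornology.IsBounded Ω) (K : M.Cell) : volume (M.cell K) < ⊤ :=
  (hΩb.subset (cell_subset M K)).measure_lt_top

lemma cellVol_pos (hΩb : Bornology.IsBounded Ω) (K : M.Cell) : 0 < M.cellVol K :=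
  ENNReal.toReal_pos (M.volume_cell_pos K).ne' (volume_cell_lt_top M hΩb K).ne

lemma dist_le_size (hΩb : Bornology.IsBounded Ω) {K : M.Cell} {x y : Space d}
    (hx : x ∈ closure (M.cell K)) (hy : y ∈ closure (M.cell K)) : dist x y ≤ M.size := by
  refine (Metric.dist_le_diam_of_mem (hΩb.subset (cell_subset M K)).closure hx hy).trans ?_
  rw [Metric.diam_closure]
  exact le_ciSup (f := fun K => Metric.diam (M.cell K)) (finite_range _).bddAbove K

lemma size_nonneg : 0 ≤ M.size := Real.iSup_nonneg fun _ => Metric.diam_nonneg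

/-- If the half-spaces `{y | ⟪n, y - x⟫ < 0}` and `{y | ⟪n', y - x⟫ < 0}` are disjoint near `x`,
then they are opposite. -/
lemma eq_neg_of_disjoint_half_balls {n n' x : Space d} (hn : ‖n‖ = 1) (hn' : ‖n'‖ = 1) {r : ℝ}
    (hr : 0 < r) (h : ∀ y ∈ Metric.ball x r, inner ℝ n (y - x) < 0 → ¬ inner ℝ n' (y - x) < 0) :
    n' = -n := by
  by_contra hcon
  -- otherwise `n + n'` points strictly out of both half-spaces
  have hpos : 0 < 1 + inner ℝ n n' := by
    have h0 : 0 < ‖n' + n‖ ^ 2 := by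
      have : n' + n ≠ 0 := fun h => hcon (eq_neg_of_add_eq_zero_left h)
      positivity
    rw [norm_add_sq_real, hn, hn', real_inner_comm] at h0
    linarith
  have hmem : x - (r / 4) • (n + n') ∈ Metric.ball x r := by
    rw [Metric.mem_ball, dist_eq_norm, sub_sub_cancel_left, norm_neg, norm_smul, Real.norm_eq_abs,
      abs_of_pos (by positivity)]
    have := norm_add_le n n'
    rw [hn, hn'] at this
    nlinarith
  have hnn : inner ℝ n n = (1 : ℝ) := by rw [real_inner_self_eq_norm_sq, hn]; norm_num
  have hnn' : inner ℝ n' n' = (1 : ℝ) := by rw [real_inner_self_eq_norm_sq, hn']; norm_num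
  refine h _ hmem ?_ ?_
  · rw [sub_sub_cancel_left, inner_neg_right, inner_smul_right, inner_add_right, hnn]
    nlinarith
  · rw [sub_sub_cancel_left, inner_neg_right, inner_smul_right, inner_add_right, hnn',
      real_inner_comm]
    nlinarith

/-- Conservativity: the two normals of an internal face of positive area are opposite. -/
lemma normal_eq_neg {σ : M.Face} {K L : M.Cell} (h : M.Separates σ K L) (hσ : M.faceArea σ ≠ 0) :
    M.normal L σ = -M.normal K σ := by
  obtain ⟨hKL, hK, hL⟩ := h
  have hne : (μHE[d - 1] : Measure (Space d)).restrict (M.face σ) ≠ 0 := by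
    intro h0
    rw [Measure.restrict_eq_zero] at h0
    simp [PolyhedralMesh.faceArea, h0] at hσ
  have : NeBot (ae ((μHE[d - 1] : Measure (Space d)).restrict (M.face σ))) := ae_neBot.2 hne
  obtain ⟨x, ⟨r, hr, hx⟩, r', hr', hx'⟩ :=
    ((M.normal_outward K σ hK).and (M.normal_outward L σ hL)).exists
  refine eq_neg_of_disjoint_half_balls (x := x) (M.norm_normal K σ hK) (M.norm_normal L σ hL)
    (lt_min hr hr') ?_
  intro y hy h1 h2
  have hyK := (hx y (Metric.ball_subset_ball (min_le_left _ _) hy)).1 h1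
  have hyL := (hx' y (Metric.ball_subset_ball (min_le_right _ _) hy)).1 h2
  exact disjoint_left.1 (M.pairwise_disjoint_cell hKL) hyK hyL

/-- A face of positive area belongs to at most two cells, as the normals of any two of them are
opposite. -/
lemma eq_or_eq_of_separates {σ : M.Face} {K L P : M.Cell} (h : M.Separates σ K L)
    (hσ : M.faceArea σ ≠ 0) (hP : σ ∈ M.facesOf P) : P = K ∨ P = L := by
  by_contra hcon
  rw [not_or] at hcon
  have h1 := normal_eq_neg M h hσ
  have h2 := normal_eq_neg M (K := K) (L := P) ⟨Ne.symm hcon.1, h.2.1, hP⟩ hσ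
  have h3 := normal_eq_neg M (K := L) (L := P) ⟨Ne.symm hcon.2, h.2.2, hP⟩ hσ
  rw [h2, h1, neg_neg] at h3
  have h4 : M.normal K σ = 0 := by
    have : (2 : ℝ) • M.normal K σ = 0 := by
      rw [two_smul]
      nth_rewrite 1 [← h3]
      exact neg_add_cancel _
    simpa using this
  have := M.norm_normal K σ h.2.1
  simp [h4] at this

variable {M}

lemma dual_subset_domain (D : DualMesh M) (σ : M.Face) : D.dual σ ⊆ Ω :=
  (subset_iUnion D.dual σ).trans D.iUnion_dual.subset

lemma faceArea_mul_dist_le (hΩb : Bornology.IsBounded Ω) (D : DualMesh M) {σ : M.Face}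
    {K L : M.Cell} (h : M.Separates σ K L) :
    M.faceArea σ * dist (D.pt K) (D.pt L) ≤ D.thetaGrad * D.dualVol σ := by
  have hpos : 0 < D.dualVol σ := ENNReal.toReal_pos (D.volume_dual_pos σ K L h).ne'
    (hΩb.subset (dual_subset_domain D σ)).measure_lt_top.ne
  rw [← div_le_iff₀ hpos, dist_comm]
  exact le_ciSup (f := fun p : {p : M.Face × M.Cell × M.Cell // M.Separates p.1 p.2.1 p.2.2} =>
    M.faceArea p.1.1 * dist (D.pt p.1.2.2) (D.pt p.1.2.1) / D.dualVol p.1.1)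
    (finite_range _).bddAbove ⟨(σ, K, L), h⟩

lemma dualVol_le (hΩb : Bornology.IsBounded Ω) (D : DualMesh M) {σ : M.Face} {K : M.Cell}
    (h : σ ∈ M.facesOf K) : D.dualVol σ ≤ D.theta * M.cellVol K := by
  rw [← div_le_iff₀ (cellVol_pos M hΩb K)]
  exact le_ciSup (f := fun p : {p : M.Cell × M.Face // p.2 ∈ M.facesOf p.1} =>
    D.dualVol p.1.2 / M.cellVol p.1.1) (finite_range _).bddAbove ⟨(K, σ), h⟩

lemma thetaGrad_nonneg (D : DualMesh M) : 0 ≤ D.thetaGrad :=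
  Real.iSup_nonneg fun _ => by
    unfold DualMesh.dualVol PolyhedralMesh.faceArea
    positivity

lemma theta_nonneg (D : DualMesh M) : 0 ≤ D.theta :=
  Real.iSup_nonneg fun _ => by
    unfold DualMesh.dualVol PolyhedralMesh.cellVol
    positivity

/-- Discrete integration by parts together with the mesh regularity: conservativity turns
the sum over the cells into a sum of differences `φ_K - φ_L` over the internal faces, which
`thetaGrad` converts into volumes of dual cells, and `theta` and the bound on the number of
faces convert these into volumes of cells. -/
lemma abs_sum_flux_le (hΩb : Bornology.IsBounded Ω) (D : DualMesh M) {Lφ : ℝ} (hLφ : 0 ≤ Lφ)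
    {φ b : M.Cell → ℝ} (hφ : ∀ K L, |φ K - φ L| ≤ Lφ * dist (D.pt K) (D.pt L))
    {V : M.Face → Space d}
    (hφ0 : ∀ σ, ∀ K, σ ∈ M.facesOf K → (¬ ∃ K L, M.Separates σ K L) → M.faceArea σ ≠ 0 → φ K = 0)
    (hb : ∀ K, 0 ≤ b K)
    (hV : ∀ σ K L, M.Separates σ K L → M.faceArea σ ≠ 0 → ‖V σ‖ ≤ b K + b L)
    {N : ℕ} (hN : ∀ K, (M.facesOf K).card ≤ N) :
    |∑ K, φ K * ∑ σ ∈ M.facesOf K, M.faceArea σ * inner ℝ (V σ) (M.normal K σ)|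
      ≤ Lφ * D.thetaGrad * (D.theta * N) * ∑ K, M.cellVol K * b K := by
  classical
  have hface : ∀ σ, |∑ K, if σ ∈ M.facesOf K then
        φ K * (M.faceArea σ * inner ℝ (V σ) (M.normal K σ)) else 0|
      ≤ Lφ * D.thetaGrad * ∑ K, if σ ∈ M.facesOf K then D.dualVol σ * b K else 0 := by
    intro σ
    have hdual0 : 0 ≤ D.dualVol σ := ENNReal.toReal_nonneg
    have hrhs : 0 ≤ Lφ * D.thetaGrad * ∑ K, if σ ∈ M.facesOf K then D.dualVol σ * b K else 0 := by
      refine mul_nonneg (mul_nonneg hLφ (thetaGrad_nonneg D)) (Finset.sum_nonneg fun K _ => ?_)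
      split_ifs
      · exact mul_nonneg hdual0 (hb K)
      · exact le_rfl
    by_cases hσ : M.faceArea σ = 0
    · simpa [hσ] using hrhs
    by_cases hint : ∃ K L, M.Separates σ K L
    · obtain ⟨K, L, hKL⟩ := hint
      have hpair : ∀ a : M.Cell → ℝ, (∑ P, if σ ∈ M.facesOf P then a P else 0) = a K + a L := by
        intro a
        rw [← Finset.sum_pair hKL.1, ← Finset.sum_filter]
        refine Finset.sum_congr ?_ fun _ _ => rfl
        ext P
        simp only [Finset.mem_filter, Finset.mem_univ, true_and, Finset.mem_insert,
          Finset.mem_singleton]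
        refine ⟨eq_or_eq_of_separates M hKL hσ, ?_⟩
        rintro (rfl | rfl)
        exacts [hKL.2.1, hKL.2.2]
      rw [hpair, hpair, normal_eq_neg M hKL hσ, inner_neg_right]
      have hA0 : 0 ≤ M.faceArea σ := ENNReal.toReal_nonneg
      have h1 : |inner ℝ (V σ) (M.normal K σ)| ≤ b K + b L := by
        refine (abs_real_inner_le_norm _ _).trans ?_
        rw [M.norm_normal K σ hKL.2.1, mul_one]
        exact hV σ K L hKL hσ
      have h2 := faceArea_mul_dist_le hΩb D hKL
      calc |φ K * (M.faceArea σ * inner ℝ (V σ) (M.normal K σ))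
              + φ L * (M.faceArea σ * -inner ℝ (V σ) (M.normal K σ))|
          = M.faceArea σ * |φ K - φ L| * |inner ℝ (V σ) (M.normal K σ)| := by
            rw [← abs_of_nonneg hA0, ← abs_mul, ← abs_mul, abs_of_nonneg hA0]
            congr 1
            ring
        _ ≤ M.faceArea σ * (Lφ * dist (D.pt K) (D.pt L)) * (b K + b L) := by
            gcongr
            exact hφ K L
        _ = Lφ * (M.faceArea σ * dist (D.pt K) (D.pt L)) * (b K + b L) := by ring
        _ ≤ Lφ * (D.thetaGrad * D.dualVol σ) * (b K + b L) := by
            have := add_nonneg (hb K) (hb L)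
            gcongr
        _ = _ := by ring
    · refine le_trans (le_of_eq ?_) hrhs
      rw [abs_eq_zero]
      refine Finset.sum_eq_zero fun K _ => ?_
      split_ifs with hK
      · rw [hφ0 σ K hK hint hσ, zero_mul]
      · rfl
  have hswap : ∀ a : M.Cell → M.Face → ℝ,
      ∑ K, ∑ σ ∈ M.facesOf K, a K σ = ∑ σ, ∑ K, if σ ∈ M.facesOf K then a K σ else 0 := by
    intro a
    rw [Finset.sum_comm]
    refine Finset.sum_congr rfl fun K _ => ?_
    rw [Finset.sum_ite_mem, Finset.univ_inter]
  simp_rw [Finset.mul_sum]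
  rw [hswap]
  refine (Finset.abs_sum_le_sum_abs _ _).trans ((Finset.sum_le_sum fun σ _ => hface σ).trans ?_)
  rw [← Finset.mul_sum, ← hswap fun K σ => D.dualVol σ * b K, ← Finset.mul_sum, mul_assoc]
  rw [mul_assoc, mul_assoc, mul_assoc]
  refine mul_le_mul_of_nonneg_left (mul_le_mul_of_nonneg_left ?_ (thetaGrad_nonneg D)) hLφ
  rw [← mul_assoc, Finset.mul_sum]
  refine Finset.sum_le_sum fun K _ => ?_
  calc ∑ σ ∈ M.facesOf K, D.dualVol σ * b K
      ≤ ∑ σ ∈ M.facesOf K, D.theta * M.cellVol K * b K :=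
        Finset.sum_le_sum fun σ hσ =>
          mul_le_mul_of_nonneg_right (dualVol_le hΩb D hσ) (hb K)
    _ = (M.facesOf K).card * (D.theta * M.cellVol K * b K) := by
        rw [Finset.sum_const, nsmul_eq_mul]
    _ ≤ N * (D.theta * M.cellVol K * b K) := by
        refine mul_le_mul_of_nonneg_right (by exact_mod_cast hN K) ?_
        exact mul_nonneg (mul_nonneg (theta_nonneg D) (cellVol_pos M hΩb K).le) (hb K)
    _ = D.theta * N * (M.cellVol K * b K) := by ring

/-- The divergence of a vector field. -/
noncomputable def divergence (ψ : Space d → Space d) (x : Space d) : ℝ :=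
  ∑ i, (fderiv ℝ ψ x (EuclideanSpace.single i 1)) i

lemma integrableOn_face (hd : 1 ≤ d) (hΩb : Bornology.IsBounded Ω) (σ : M.Face)
    {ψ : Space d → Space d} (hψ : Continuous ψ) (hψc : HasCompactSupport ψ) :
    IntegrableOn ψ (M.face σ) (μHE[d - 1] : Measure (Space d)) := by
  have : IsFiniteMeasure ((μHE[d - 1] : Measure (Space d)).restrict (M.face σ)) :=
    ⟨by rw [Measure.restrict_apply_univ]; exact measure_face_lt_top M hd hΩb σ⟩
  obtain ⟨C, hC⟩ := hψ.bounded_above_of_compact_support hψc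
  exact Integrable.of_bound hψ.aestronglyMeasurable C (Eventually.of_forall hC)

variable (M) in
/-- The Gauss formula on a cell, in terms of the mean values over its faces. A face of zero area,
whose mean value is the junk value `0`, contributes to neither side. -/
theorem sum_faceArea_mul_inner_average (hd : 1 ≤ d) (hΩb : Bornology.IsBounded Ω) (K : M.Cell)
    {ψ : Space d → Space d} (hψ : ContDiff ℝ 1 ψ) (hψc : HasCompactSupport ψ) :
    ∑ σ ∈ M.facesOf K,
        M.faceArea σ * inner ℝ (⨍ z in M.face σ, ψ z ∂μHE[d - 1]) (M.normal K σ)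
      = ∫ x in M.cell K, divergence ψ x := by
  have hKb := hΩb.subset (cell_subset M K)
  have hcomp : ∀ i, ContDiff ℝ 1 fun x => ψ x i := fun i => by fun_prop
  have hcompc : ∀ i, HasCompactSupport fun x => ψ x i := fun i =>
    hψc.comp_left (g := fun v : Space d => v i) rfl
  have hder : ∀ i x, fderiv ℝ (fun x => ψ x i) x (EuclideanSpace.single i 1)
      = (fderiv ℝ ψ x (EuclideanSpace.single i 1)) i := by
    intro i x
    have h1 := ((EuclideanSpace.proj i : Space d →L[ℝ] ℝ).hasFDerivAt
      (x := ψ x)).comp x ((hψ.differentiable one_ne_zero x).hasFDerivAt)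
    have h2 := h1.fderiv
    change fderiv ℝ (fun x => ψ x i) x = _ at h2
    rw [h2]
    rfl
  have hint : ∀ i, IntegrableOn (fun x => (fderiv ℝ ψ x (EuclideanSpace.single i 1)) i)
      (M.cell K) := by
    intro i
    simp_rw [← hder]
    exact ((((hcomp i).continuous_fderiv one_ne_zero).clm_apply
      continuous_const).integrable_of_hasCompactSupport
      ((hcompc i).fderiv_apply ℝ _)).integrableOn
  unfold divergence
  rw [integral_finsetSum _ fun i _ => hint i]
  have hgauss : ∀ i, ∫ x in M.cell K, (fderiv ℝ ψ x (EuclideanSpace.single i 1)) i =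
      ∑ σ ∈ M.facesOf K, M.normal K σ i * ∫ z in M.face σ, ψ z i ∂μHE[d - 1] := by
    intro i
    simp_rw [← hder]
    rw [← sum_inner_normal_mul_setIntegral_face M hd hKb _ (hcomp i) (hcompc i)]
    refine Finset.sum_congr rfl fun σ _ => ?_
    rw [EuclideanSpace.inner_single_right]
    simp
  rw [Finset.sum_congr rfl fun i _ => hgauss i, Finset.sum_comm]
  refine Finset.sum_congr rfl fun σ _ => ?_
  have hfin := measure_face_lt_top M hd hΩb σ
  have hψi := integrableOn_face hd hΩb σ hψ.continuous hψc
  have hcoord : ∀ i, (∫ z in M.face σ, ψ z ∂(μHE[d - 1] : Measure (Space d))) i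
      = ∫ z in M.face σ, ψ z i ∂μHE[d - 1] := fun i =>
    ((EuclideanSpace.proj i : Space d →L[ℝ] ℝ).integral_comp_comm hψi).symm
  rw [setAverage_eq, inner_smul_left, ← mul_assoc]
  by_cases hσ : M.faceArea σ = 0
  · have h0 : (μHE[d - 1] : Measure (Space d)).restrict (M.face σ) = 0 := by
      rw [Measure.restrict_eq_zero]
      exact ((ENNReal.toReal_eq_zero_iff _).1 hσ).resolve_right hfin.ne
    simp [h0]
  · have : M.faceArea σ *
        (starRingEnd ℝ) ((μHE[d - 1] : Measure (Space d)).real (M.face σ))⁻¹ = 1 :=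
      mul_inv_cancel₀ hσ
    rw [this, one_mul, PiLp.inner_apply]
    simp [hcoord]

lemma norm_setAverage_sub_le {α E : Type*} [MeasurableSpace α] [NormedAddCommGroup E]
    [NormedSpace ℝ E] [CompleteSpace E] {μ : Measure α} {s : Set α} (hs : MeasurableSet s)
    (h0 : μ s ≠ 0) (hfin : μ s ≠ ⊤) {f : α → E} (hf : IntegrableOn f s μ) {a : E} {C : ℝ}
    (h : ∀ z ∈ s, ‖f z - a‖ ≤ C) : ‖(⨍ z in s, f z ∂μ) - a‖ ≤ C := by
  have hmem : (⨍ z in s, f z ∂μ) ∈ Metric.closedBall a C := by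
    refine (convex_closedBall a C).set_average_mem Metric.isClosed_closedBall h0 hfin ?_ hf
    refine ae_restrict_of_forall_mem hs fun z hz => ?_
    rw [mem_closedBall_iff_norm]
    exact h z hz
  rwa [mem_closedBall_iff_norm] at hmem

lemma norm_average_face_sub_le (hd : 1 ≤ d) (hΩb : Bornology.IsBounded Ω) {σ : M.Face}
    (hσ : M.faceArea σ ≠ 0) {ψ : Space d → Space d} (hψ : Continuous ψ) (hψc : HasCompactSupport ψ)
    {a : Space d} {C : ℝ} (h : ∀ z ∈ M.face σ, ‖ψ z - a‖ ≤ C) :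
    ‖(⨍ z in M.face σ, ψ z ∂μHE[d - 1]) - a‖ ≤ C := by
  have hfin := measure_face_lt_top M hd hΩb σ
  have h0 : (μHE[d - 1] : Measure (Space d)) (M.face σ) ≠ 0 := fun h0 => hσ (by
    simp [PolyhedralMesh.faceArea, h0])
  exact norm_setAverage_sub_le (M.measurableSet_face σ) h0 hfin.ne
    (integrableOn_face hd hΩb σ hψ hψc) h

end Geometry

/-! ### Space-time cells and Riemann sums -/

section TimeGrid

variable {T : ℝ} (G : TimeGrid T)

lemma t_mono {m n : ℕ} (hmn : m ≤ n) (hn : n ≤ G.N) : G.t m ≤ G.t n := by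
  induction n, hmn using Nat.le_induction with
  | base => exact le_rfl
  | succ k _ ih => exact (ih (by omega)).trans (G.t_lt k (by omega)).le

lemma sub_le_step {n : ℕ} (hn : n < G.N) : G.t (n + 1) - G.t n ≤ G.step :=
  le_ciSup (f := fun n : Fin G.N => G.t (n + 1) - G.t n) (finite_range _).bddAbove ⟨n, hn⟩

lemma step_nonneg : 0 ≤ G.step :=
  Real.iSup_nonneg fun n => sub_nonneg.2 (G.t_lt n n.2).le

lemma iUnion_Ioc_t : ⋃ n ∈ Finset.range G.N, Ioc (G.t n) (G.t (n + 1)) = Ioc 0 T := by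
  have h : ∀ k ≤ G.N, ⋃ n ∈ Finset.range k, Ioc (G.t n) (G.t (n + 1)) = Ioc (G.t 0) (G.t k) := by
    intro k hk
    induction k with
    | zero => simp
    | succ k ih =>
      rw [Finset.range_add_one, Finset.set_biUnion_insert, ih (by omega), union_comm,
        Ioc_union_Ioc_eq_Ioc (t_mono G (Nat.zero_le k) (by omega)) (G.t_lt k (by omega)).le]
  rw [h G.N le_rfl, G.t_zero, G.t_last]

lemma disjoint_Ioc_t {m n : ℕ} (hm : m < G.N) (hn : n < G.N) (hmn : m ≠ n) :
    Disjoint (Ioc (G.t m) (G.t (m + 1))) (Ioc (G.t n) (G.t (n + 1))) := by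
  wlog h : m < n generalizing m n
  · exact (this hn hm hmn.symm (by omega)).symm
  rw [disjoint_left]
  intro s hs hs'
  exact absurd (hs.2.trans (t_mono G (Nat.succ_le_of_lt h) hn.le)) hs'.1.not_ge

end TimeGrid

section Blocks

variable {d : ℕ} {Ω : Set (Space d)} {T : ℝ} (M : PolyhedralMesh Ω) (G : TimeGrid T)

/-- The space-time cell `K × (t_n, t_{n+1}]`. -/
def block (p : ℕ × M.Cell) : Set (Space d × ℝ) := M.cell p.2 ×ˢ Ioc (G.t p.1) (G.t (p.1 + 1))

/-- The indices `(n, K)` of the space-time cells, with `n < N`. -/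
def blockIndex : Finset (ℕ × M.Cell) := Finset.range G.N ×ˢ Finset.univ

/-- The measure `|K| (t_{n+1} - t_n)` of a space-time cell. -/
noncomputable def blockVol (p : ℕ × M.Cell) : ℝ := M.cellVol p.2 * (G.t (p.1 + 1) - G.t p.1)

variable {M G} in
lemma lt_of_mem_blockIndex {p : ℕ × M.Cell} (hp : p ∈ blockIndex M G) : p.1 < G.N := by
  simpa [blockIndex] using hp

lemma measurableSet_block (p : ℕ × M.Cell) : MeasurableSet (block M G p) :=
  (M.measurableSet_cell _).prod measurableSet_Ioc

lemma measureReal_block {p : ℕ × M.Cell} (hp : p ∈ blockIndex M G) :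
    volume.real (block M G p) = blockVol M G p := by
  rw [Measure.real, block, Measure.volume_eq_prod, Measure.prod_prod, ENNReal.toReal_mul,
    Real.volume_Ioc, ENNReal.toReal_ofReal
      (sub_nonneg.2 (G.t_lt _ (lt_of_mem_blockIndex hp)).le)]
  rfl

lemma volume_block_lt_top (hΩb : Bornology.IsBounded Ω) (p : ℕ × M.Cell) :
    volume (block M G p) < ⊤ := by
  rw [block, Measure.volume_eq_prod, Measure.prod_prod, Real.volume_Ioc]
  exact ENNReal.mul_lt_top (volume_cell_lt_top M hΩb _) ENNReal.ofReal_lt_top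

lemma iUnion_block : ⋃ p ∈ blockIndex M G, block M G p = Ω ×ˢ Ioc 0 T := by
  ext ⟨x, s⟩
  have hx : x ∈ Ω ↔ ∃ K, x ∈ M.cell K := by
    rw [← mem_iUnion]
    exact ⟨fun h => M.iUnion_cell.symm.subset h, fun h => M.iUnion_cell.subset h⟩
  have hs : s ∈ Ioc 0 T ↔ ∃ n < G.N, s ∈ Ioc (G.t n) (G.t (n + 1)) := by
    rw [← iUnion_Ioc_t G]
    simp only [mem_iUnion, Finset.mem_range, exists_prop]
  rw [mem_prod, hx, hs]
  simp only [mem_iUnion, exists_prop, block, blockIndex, mem_prod, Finset.mem_product,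
    Finset.mem_range, Finset.mem_univ, and_true, Prod.exists]
  constructor
  · rintro ⟨n, K, h1, h2, h3⟩
    exact ⟨⟨K, h2⟩, n, h1, h3⟩
  · rintro ⟨⟨K, h2⟩, n, h1, h3⟩
    exact ⟨n, K, h1, h2, h3⟩

lemma pairwiseDisjoint_block :
    (blockIndex M G : Set (ℕ × M.Cell)).PairwiseDisjoint (block M G) := by
  rintro ⟨n, K⟩ hp ⟨n', K'⟩ hp' hne
  have hn := lt_of_mem_blockIndex (Finset.mem_coe.1 hp)
  have hn' := lt_of_mem_blockIndex (Finset.mem_coe.1 hp')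
  by_cases hK : K = K'
  · subst hK
    exact Disjoint.set_prod_right (disjoint_Ioc_t G hn hn' fun h => hne (by simp_all)) _ _
  · exact Disjoint.set_prod_left (M.pairwise_disjoint_cell hK) _ _

lemma spaceTimeMeasure_eq (Ω : Set (Space d)) (T : ℝ) :
    spaceTimeMeasure Ω T = volume.restrict (Ω ×ˢ Ioc 0 T) := by
  unfold spaceTimeMeasure
  rw [Measure.volume_eq_prod, ← Measure.prod_restrict, ← Measure.prod_restrict,
    restrict_Ioo_eq_restrict_Ioc]

lemma integrableOn_block {E : Type*} [NormedAddCommGroup E] {g : Space d × ℝ → E}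
    (hg : Integrable g (spaceTimeMeasure Ω T)) {p : ℕ × M.Cell} (hp : p ∈ blockIndex M G) :
    IntegrableOn g (block M G p) := by
  rw [spaceTimeMeasure_eq, ← iUnion_block M G] at hg
  exact IntegrableOn.mono_set hg fun z hz => mem_biUnion (Finset.mem_coe.2 hp) hz

lemma integral_eq_sum_block {g : Space d × ℝ → ℝ} (hg : Integrable g (spaceTimeMeasure Ω T)) :
    ∫ z, g z ∂(spaceTimeMeasure Ω T) = ∑ p ∈ blockIndex M G, ∫ z in block M G p, g z := by
  rw [spaceTimeMeasure_eq, ← iUnion_block M G]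
  exact integral_biUnion_finset _ (fun p _ => measurableSet_block M G p)
    (pairwiseDisjoint_block M G) fun p hp => integrableOn_block M G hg hp

lemma discreteFunction_eq {u : ℕ → M.Cell → ℝ} {p : ℕ × M.Cell} (hp : p ∈ blockIndex M G)
    {z : Space d × ℝ} (hz : z ∈ block M G p) : discreteFunction M G u z = u p.1 p.2 := by
  have h1 : discreteFunction M G u z
      = ∑ q ∈ blockIndex M G, (block M G q).indicator (fun _ => u q.1 q.2) z := by
    unfold discreteFunction blockIndex block
    rw [Finset.sum_product]
  rw [h1, Finset.sum_eq_single p, indicator_of_mem hz]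
  · intro q hq hqp
    refine indicator_of_notMem (fun hzq => ?_) _
    exact disjoint_left.1
      (pairwiseDisjoint_block M G (Finset.mem_coe.2 hq) (Finset.mem_coe.2 hp) hqp) hzq hz
  · exact fun h => absurd hp h

/-- A Riemann sum over the space-time cells approximates an integral. -/
lemma abs_sum_block_sub_integral_le (hΩb : Bornology.IsBounded Ω) {g : Space d × ℝ → ℝ}
    (hg : Integrable g (spaceTimeMeasure Ω T)) {a r : ℕ × M.Cell → ℝ}
    (h : ∀ p ∈ blockIndex M G, ∀ z ∈ block M G p, |a p - g z| ≤ r p) :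
    |∑ p ∈ blockIndex M G, blockVol M G p * a p - ∫ z, g z ∂(spaceTimeMeasure Ω T)|
      ≤ ∑ p ∈ blockIndex M G, blockVol M G p * r p := by
  rw [integral_eq_sum_block M G hg, ← Finset.sum_sub_distrib]
  refine (Finset.abs_sum_le_sum_abs _ _).trans (Finset.sum_le_sum fun p hp => ?_)
  have hfin := volume_block_lt_top M G hΩb p
  have hc : IntegrableOn (fun _ => a p) (block M G p) := integrableOn_const hfin.ne
  have h1 : blockVol M G p * a p - ∫ z in block M G p, g z = ∫ z in block M G p, (a p - g z) := by
    rw [integral_sub hc (integrableOn_block M G hg hp), setIntegral_const,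
      measureReal_block M G hp, smul_eq_mul]
  rw [h1, ← measureReal_block M G hp, mul_comm]
  exact norm_setIntegral_le_of_norm_le_const (f := fun z => a p - g z) hfin (h p hp)

lemma sum_block_eq_integral (hΩb : Bornology.IsBounded Ω) {g : Space d × ℝ → ℝ}
    (hg : Integrable g (spaceTimeMeasure Ω T)) {a : ℕ × M.Cell → ℝ}
    (h : ∀ p ∈ blockIndex M G, ∀ z ∈ block M G p, a p = g z) :
    ∑ p ∈ blockIndex M G, blockVol M G p * a p = ∫ z, g z ∂(spaceTimeMeasure Ω T) := by
  have := abs_sum_block_sub_integral_le M G hΩb hg (a := a) (r := 0)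
    fun p hp z hz => by simp [h p hp z hz]
  simpa [sub_eq_zero] using this

lemma sum_block_le_integral_add (hΩb : Bornology.IsBounded Ω) {g : Space d × ℝ → ℝ}
    (hg : Integrable g (spaceTimeMeasure Ω T)) {a : ℕ × M.Cell → ℝ} {r : ℝ}
    (h : ∀ p ∈ blockIndex M G, ∀ z ∈ block M G p, |a p - g z| ≤ r) :
    ∑ p ∈ blockIndex M G, blockVol M G p * a p
      ≤ ∫ z, g z ∂(spaceTimeMeasure Ω T) + r * ∑ p ∈ blockIndex M G, blockVol M G p := by
  have := (abs_le.1 (abs_sum_block_sub_integral_le M G hΩb hg h)).2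
  rw [← Finset.sum_mul] at this
  linarith

lemma isFiniteMeasure_spaceTimeMeasure (hΩb : Bornology.IsBounded Ω) (T : ℝ) :
    IsFiniteMeasure (spaceTimeMeasure Ω T) := by
  refine ⟨?_⟩
  unfold spaceTimeMeasure
  rw [Measure.restrict_apply_univ, Measure.volume_eq_prod, Measure.prod_prod, Real.volume_Ioo]
  exact ENNReal.mul_lt_top hΩb.measure_lt_top ENNReal.ofReal_lt_top

lemma sum_blockVol (hΩb : Bornology.IsBounded Ω) :
    ∑ p ∈ blockIndex M G, blockVol M G p = (spaceTimeMeasure Ω T).real univ := by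
  have := isFiniteMeasure_spaceTimeMeasure hΩb T
  have h := sum_block_eq_integral M G hΩb (g := fun _ => 1) (integrable_const _) (a := fun _ => 1)
    fun _ _ _ _ => rfl
  simpa using h

lemma dist_le_of_mem_block (hΩb : Bornology.IsBounded Ω) {p : ℕ × M.Cell} (hp : p ∈ blockIndex M G)
    {z : Space d × ℝ} (hz : z ∈ block M G p) {x : Space d} (hx : x ∈ M.cell p.2) {s : ℝ}
    (hs : s ∈ Icc (G.t p.1) (G.t (p.1 + 1))) : dist (x, s) z ≤ M.size + G.step := by
  rw [Prod.dist_eq]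
  have h1 := dist_le_size M hΩb (subset_closure hx) (subset_closure hz.1)
  have h2 : dist s z.2 ≤ G.step := by
    refine le_trans ?_ (sub_le_step G (lt_of_mem_blockIndex hp))
    rw [Real.dist_eq, abs_le]
    constructor <;> linarith [hs.1, hs.2, hz.2.1, hz.2.2]
  exact max_le (h1.trans (le_add_of_nonneg_right (step_nonneg G)))
    (h2.trans (le_add_of_nonneg_left (size_nonneg M)))

end Blocks

/-! ### Test functions on space-time -/

section TestFunctions

variable {d : ℕ}

lemma hasCompactSupport_slice {E : Type*} [Zero E] {f : Space d × ℝ → E}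
    (hf : HasCompactSupport f) (t : ℝ) : HasCompactSupport fun x => f (x, t) := by
  refine HasCompactSupport.intro (IsCompact.image hf continuous_fst) fun x hx => ?_
  by_contra h
  exact hx ⟨(x, t), subset_tsupport f h, rfl⟩

lemma contDiff_slice {E : Type*} [NormedAddCommGroup E] [NormedSpace ℝ E] {f : Space d × ℝ → E}
    {n : WithTop ℕ∞} (hf : ContDiff ℝ n f) (t : ℝ) : ContDiff ℝ n fun x => f (x, t) :=
  hf.comp (contDiff_prodMk_left t)

lemma fderiv_slice {E : Type*} [NormedAddCommGroup E] [NormedSpace ℝ E] {f : Space d × ℝ → E}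
    (hf : Differentiable ℝ f) (x : Space d) (t : ℝ) (v : Space d) :
    fderiv ℝ (fun x => f (x, t)) x v = fderiv ℝ f (x, t) (v, 0) := by
  have h := (HasFDerivAt.comp (f := fun y : Space d => (y, t)) x (hf (x, t)).hasFDerivAt
    (hasFDerivAt_prodMk_left x t)).fderiv
  change fderiv ℝ (fun x => f (x, t)) x = _ at h
  rw [h]
  simp

lemma hasDerivAt_slice {f : Space d × ℝ → ℝ} (hf : Differentiable ℝ f) (x : Space d) (t : ℝ) :
    HasDerivAt (fun s => f (x, s)) (fderiv ℝ f (x, t) (0, 1)) t := by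
  have h := ((hf (x, t)).hasFDerivAt.comp t (hasFDerivAt_prodMk_right x t)).hasDerivAt
  simpa [Function.comp_def] using h

lemma contDiff_fderiv_apply {E : Type*} [NormedAddCommGroup E] [NormedSpace ℝ E]
    {f : Space d × ℝ → E} (hf : ContDiff ℝ ∞ f) (v : Space d × ℝ) :
    ContDiff ℝ ∞ fun z => fderiv ℝ f z v :=
  (hf.fderiv_right (m := ∞) le_rfl).clm_apply contDiff_const

/-- The divergence with respect to the space variable of a time-dependent vector field. -/
noncomputable def spaceDivergence (ψ : Space d × ℝ → Space d) (z : Space d × ℝ) : ℝ :=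
  ∑ i, (fderiv ℝ ψ z (EuclideanSpace.single i 1, 0)) i

lemma divergence_slice {ψ : Space d × ℝ → Space d} (hψ : Differentiable ℝ ψ) (x : Space d) (t : ℝ) :
    divergence (fun x => ψ (x, t)) x = spaceDivergence ψ (x, t) := by
  simp only [divergence, spaceDivergence, fderiv_slice hψ]

lemma contDiff_spaceDivergence {ψ : Space d × ℝ → Space d} (hψ : ContDiff ℝ ∞ ψ) :
    ContDiff ℝ ∞ (spaceDivergence ψ) := by
  unfold spaceDivergence
  refine ContDiff.sum fun i _ => ?_
  have := contDiff_fderiv_apply hψ (EuclideanSpace.single i 1, 0)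
  fun_prop

lemma hasCompactSupport_spaceDivergence {ψ : Space d × ℝ → Space d} (hψ : HasCompactSupport ψ) :
    HasCompactSupport (spaceDivergence ψ) := by
  refine (hψ.fderiv ℝ).comp_left (g := fun A : Space d × ℝ →L[ℝ] Space d =>
    ∑ i, (A (EuclideanSpace.single i 1, 0)) i) ?_
  simp

/-- Integration by parts in space. -/
lemma integral_mul_spaceDivergence {Ω : Set (Space d)} {T : ℝ}
    {φ : Space d × ℝ → ℝ} (hφ : ContDiff ℝ ∞ φ) (hφc : HasCompactSupport φ)
    (hφs : tsupport φ ⊆ Ω ×ˢ Iio T) {ψ : Space d × ℝ → Space d} (hψ : ContDiff ℝ ∞ ψ)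
    (hψc : HasCompactSupport ψ) :
    ∫ z, φ z * spaceDivergence ψ z ∂(spaceTimeMeasure Ω T)
      = -∫ z, fderiv ℝ φ z (ψ z, 0) ∂(spaceTimeMeasure Ω T) := by
  have hφd := hφ.differentiable (by simp)
  have hψd := hψ.differentiable (by simp)
  have hmeas : MeasurableSet ((univ : Set (Space d)) ×ˢ Ioo 0 T) :=
    MeasurableSet.univ.prod measurableSet_Ioo
  have hsub : Ω ×ˢ Ioo 0 T ⊆ (univ : Set (Space d)) ×ˢ Ioo 0 T := prod_mono (subset_univ _) le_rfl
  have hout : ∀ z ∈ ((univ : Set (Space d)) ×ˢ Ioo 0 T) \ (Ω ×ˢ Ioo 0 T), z ∉ tsupport φ := by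
    rintro z ⟨hz1, hz2⟩ hz
    exact hz2 ⟨(hφs hz).1, hz1.2⟩
  have hcont1 : Continuous fun z => φ z * spaceDivergence ψ z :=
    hφ.continuous.mul (contDiff_spaceDivergence hψ).continuous
  have hcs1 : HasCompactSupport fun z => φ z * spaceDivergence ψ z := hφc.mul_right
  have hcont2 : Continuous fun z => fderiv ℝ φ z (ψ z, 0) :=
    (hφ.continuous_fderiv (by simp)).clm_apply (hψ.continuous.prodMk continuous_const)
  have hcs2 : HasCompactSupport fun z => fderiv ℝ φ z (ψ z, 0) := by
    refine (hφc.fderiv ℝ).mono fun z hz h => hz ?_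
    simp only at h ⊢
    rw [h]
    simp
  unfold spaceTimeMeasure
  rw [← setIntegral_eq_of_subset_of_forall_sdiff_eq_zero hmeas hsub fun z hz => by
      rw [image_eq_zero_of_notMem_tsupport (hout z hz), zero_mul],
    ← setIntegral_eq_of_subset_of_forall_sdiff_eq_zero hmeas hsub fun z hz => by
      rw [image_eq_zero_of_notMem_tsupport fun h => hout z hz (tsupport_fderiv_subset ℝ h)]
      simp,
    Measure.volume_eq_prod, ← Measure.prod_restrict, Measure.restrict_univ]
  have hr : (volume : Measure (Space d)).prod (volume.restrict (Ioo 0 T))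
      ≤ (volume : Measure (Space d × ℝ)) := by
    conv_lhs => rw [← Measure.restrict_univ (μ := (volume : Measure (Space d)))]
    rw [Measure.prod_restrict]
    exact Measure.restrict_le_self
  rw [integral_prod_symm _ ((hcont1.integrable_of_hasCompactSupport hcs1).mono_measure hr),
    integral_prod_symm _ ((hcont2.integrable_of_hasCompactSupport hcs2).mono_measure hr),
    ← integral_neg]
  congr 1
  funext t
  have hφt := contDiff_slice hφ t
  have hφtc := hasCompactSupport_slice hφc t
  have hψt : ∀ i, ContDiff ℝ ∞ fun x => ψ (x, t) i := fun i => by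
    have := contDiff_slice hψ t
    fun_prop
  have hψtc : ∀ i, HasCompactSupport fun x => ψ (x, t) i := fun i =>
    (hasCompactSupport_slice hψc t).comp_left (g := fun v : Space d => v i) rfl
  have hder : ∀ i x, (fderiv ℝ ψ (x, t) (EuclideanSpace.single i 1, 0)) i
      = fderiv ℝ (fun x => ψ (x, t) i) x (EuclideanSpace.single i 1) := by
    intro i x
    rw [fderiv_slice (f := fun z => ψ z i) (by fun_prop)]
    have h := ((EuclideanSpace.proj i : Space d →L[ℝ] ℝ).hasFDerivAt.comp (x, t)
      (hψd (x, t)).hasFDerivAt).fderiv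
    change fderiv ℝ (fun z => ψ z i) (x, t) = _ at h
    rw [h]
    rfl
  have hlin : ∀ x, fderiv ℝ φ (x, t) (ψ (x, t), 0)
      = ∑ i, fderiv ℝ (fun x => φ (x, t)) x (EuclideanSpace.single i 1) * ψ (x, t) i := by
    intro x
    rw [← fderiv_slice hφd]
    conv_lhs => rw [← (EuclideanSpace.basisFun (Fin d) ℝ).sum_repr (ψ (x, t))]
    rw [map_sum]
    refine Finset.sum_congr rfl fun i _ => ?_
    simp [mul_comm]
  have hi1 : ∀ i, Integrable fun x =>
      fderiv ℝ (fun x => φ (x, t)) x (EuclideanSpace.single i 1) * ψ (x, t) i := fun i =>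
    (((hφt.continuous_fderiv (by simp)).clm_apply continuous_const).mul
      (hψt i).continuous).integrable_of_hasCompactSupport (hψtc i).mul_left
  have hi2 : ∀ i, Integrable fun x =>
      φ (x, t) * fderiv ℝ (fun x => ψ (x, t) i) x (EuclideanSpace.single i 1) := fun i =>
    (hφt.continuous.mul (((hψt i).continuous_fderiv (by simp)).clm_apply
      continuous_const)).integrable_of_hasCompactSupport hφtc.mul_right
  have hi3 : ∀ i, Integrable fun x => φ (x, t) * ψ (x, t) i := fun i =>
    (hφt.continuous.mul (hψt i).continuous).integrable_of_hasCompactSupport hφtc.mul_right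
  simp only [spaceDivergence, hder, hlin, Finset.mul_sum]
  rw [integral_finsetSum _ fun i _ => hi2 i, integral_finsetSum _ fun i _ => hi1 i,
    ← Finset.sum_neg_distrib]
  refine Finset.sum_congr rfl fun i _ => ?_
  exact integral_mul_fderiv_eq_neg_fderiv_mul_of_integrable (hi1 i) (hi2 i) (hi3 i)
    (fun x _ => hφt.differentiable (by simp) x) (fun x _ => (hψt i).differentiable (by simp) x)

end TestFunctions

/-! ### The discrete weak form of the scheme -/

section Scheme

variable {d : ℕ} {Ω : Set (Space d)} {T : ℝ} {M : PolyhedralMesh Ω} {G : TimeGrid T}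

lemma sum_range_succ_sub_mul (a b : ℕ → ℝ) (N : ℕ) (hb : b N = 0) :
    ∑ n ∈ Finset.range N, (a (n + 1) - a n) * b (n + 1)
      = -(a 0 * b 0) - ∑ n ∈ Finset.range N, a n * (b (n + 1) - b n) := by
  have h : ∑ n ∈ Finset.range N, (a (n + 1) * b (n + 1) - a n * b n) = a N * b N - a 0 * b 0 :=
    Finset.sum_range_sub (fun n => a n * b n) N
  rw [hb, mul_zero, zero_sub] at h
  rw [← h, ← Finset.sum_sub_distrib]
  exact Finset.sum_congr rfl fun n _ => by ring

/-- The flux part of the weak form of the scheme, with the test values `b n K`. -/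
noncomputable def fluxSum (M : PolyhedralMesh Ω) (G : TimeGrid T) (Fnum : ℕ → M.Face → Space d)
    (b : ℕ → M.Cell → ℝ) : ℝ :=
  ∑ n ∈ Finset.range G.N, (G.t (n + 1) - G.t n) * ∑ K, b (n + 1) K *
    ∑ σ ∈ M.facesOf K, M.faceArea σ * inner ℝ (Fnum n σ) (M.normal K σ)

/-- The discrete weak form of the scheme: summation by parts in time. -/
lemma fluxSum_eq {u₀ : Space d → ℝ} {Fnum : ℕ → M.Face → Space d} {u : ℕ → M.Cell → ℝ}
    (h : IsFiniteVolumeSolution M G u₀ Fnum u) {b : ℕ → M.Cell → ℝ} (hb : ∀ K, b G.N K = 0) :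
    fluxSum M G Fnum b = ∑ K, M.cellVol K * (u 0 K * b 0 K) +
      ∑ p ∈ blockIndex M G, blockVol M G p *
        (u p.1 p.2 * ((b (p.1 + 1) p.2 - b p.1 p.2) / (G.t (p.1 + 1) - G.t p.1))) := by
  have h1 : fluxSum M G Fnum b = -∑ K, M.cellVol K * ∑ n ∈ Finset.range G.N,
      (u (n + 1) K - u n K) * b (n + 1) K := by
    simp_rw [Finset.mul_sum]
    rw [Finset.sum_comm, ← Finset.sum_neg_distrib]
    refine Finset.sum_congr rfl fun n hn => ?_
    have hn' := Finset.mem_range.1 hn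
    have hpos : G.t (n + 1) - G.t n ≠ 0 := (sub_pos.2 (G.t_lt n hn')).ne'
    rw [Finset.mul_sum, ← Finset.sum_neg_distrib]
    refine Finset.sum_congr rfl fun K _ => ?_
    rw [eq_neg_of_add_eq_zero_right (h.2 n hn' K)]
    field_simp
  have h2 : ∑ p ∈ blockIndex M G, blockVol M G p *
        (u p.1 p.2 * ((b (p.1 + 1) p.2 - b p.1 p.2) / (G.t (p.1 + 1) - G.t p.1)))
      = ∑ K, M.cellVol K * ∑ n ∈ Finset.range G.N, u n K * (b (n + 1) K - b n K) := by
    simp_rw [Finset.mul_sum]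
    rw [Finset.sum_comm, blockIndex, Finset.sum_product]
    refine Finset.sum_congr rfl fun n hn => Finset.sum_congr rfl fun K _ => ?_
    have hpos : G.t (n + 1) - G.t n ≠ 0 := (sub_pos.2 (G.t_lt n (Finset.mem_range.1 hn))).ne'
    simp only [blockVol]
    field_simp
  rw [h1, h2, ← Finset.sum_neg_distrib, ← Finset.sum_add_distrib]
  refine Finset.sum_congr rfl fun K _ => ?_
  rw [sum_range_succ_sub_mul (fun n => u n K) (fun n => b n K) G.N (hb K)]
  ring

lemma abs_initial_sub_le (hΩb : Bornology.IsBounded Ω) (D : DualMesh M) {u₀ : Space d → ℝ}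
    (hu₀ : IntegrableOn u₀ Ω) {φ₀ : Space d → ℝ} {L : NNReal} (hφ₀ : LipschitzWith L φ₀)
    {B : ℝ} (hB : ∀ x, |φ₀ x| ≤ B) :
    |∑ K, M.cellVol K * ((1 / M.cellVol K) * (∫ x in M.cell K, u₀ x) * φ₀ (D.pt K))
        - ∫ x in Ω, u₀ x * φ₀ x| ≤ L * M.size * ∫ x in Ω, |u₀ x| := by
  have hsplit : ∀ f : Space d → ℝ, IntegrableOn f Ω →
      ∫ x in Ω, f x = ∑ K, ∫ x in M.cell K, f x := by
    intro f hf
    have h := integral_iUnion_fintype (fun K => M.measurableSet_cell K) M.pairwise_disjoint_cell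
      (f := f) (μ := volume) fun K => hf.mono_set (cell_subset M K)
    rw [← h]
    exact congrArg (fun s => ∫ x in s, f x) M.iUnion_cell.symm
  have hprod : IntegrableOn (fun x => u₀ x * φ₀ x) Ω :=
    hu₀.mul_bdd (c := B) hφ₀.continuous.aestronglyMeasurable (Eventually.of_forall hB)
  rw [hsplit _ hprod, hsplit _ hu₀.abs, ← Finset.sum_sub_distrib, Finset.mul_sum]
  refine (Finset.abs_sum_le_sum_abs _ _).trans (Finset.sum_le_sum fun K _ => ?_)
  have hK := (cellVol_pos M hΩb K).ne'
  have huK := hu₀.mono_set (cell_subset M K)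
  have h1 : M.cellVol K * ((1 / M.cellVol K) * (∫ x in M.cell K, u₀ x) * φ₀ (D.pt K))
      - ∫ x in M.cell K, u₀ x * φ₀ x = ∫ x in M.cell K, u₀ x * (φ₀ (D.pt K) - φ₀ x) := by
    simp_rw [mul_sub]
    rw [integral_sub (huK.mul_const _) (hprod.mono_set (cell_subset M K)), integral_mul_const]
    field_simp
  rw [h1, ← integral_const_mul, ← Real.norm_eq_abs]
  refine norm_integral_le_of_norm_le (huK.abs.const_mul _) ?_
  refine ae_restrict_of_forall_mem (M.measurableSet_cell K) fun x hx => ?_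
  rw [norm_mul, mul_comm, Real.norm_eq_abs, Real.norm_eq_abs, ← Real.dist_eq]
  refine mul_le_mul_of_nonneg_right ((hφ₀.dist_le_mul _ _).trans ?_) (abs_nonneg _)
  exact mul_le_mul_of_nonneg_left
    (dist_le_size M hΩb (subset_closure (D.pt_mem K)) (subset_closure hx)) L.2

lemma abs_time_sub_le (hΩb : Bornology.IsBounded Ω) (D : DualMesh M) {u : ℕ → M.Cell → ℝ}
    (hu : Integrable (discreteFunction M G u) (spaceTimeMeasure Ω T)) {φ : Space d × ℝ → ℝ}
    (hφ : Differentiable ℝ φ) {L : NNReal} (hL : LipschitzWith L fun z => fderiv ℝ φ z (0, 1))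
    {B : ℝ} (hB : ∀ z, |fderiv ℝ φ z (0, 1)| ≤ B) :
    |∑ p ∈ blockIndex M G, blockVol M G p * (u p.1 p.2 *
          ((φ (D.pt p.2, G.t (p.1 + 1)) - φ (D.pt p.2, G.t p.1)) / (G.t (p.1 + 1) - G.t p.1)))
        - ∫ z, discreteFunction M G u z * fderiv ℝ φ z (0, 1) ∂(spaceTimeMeasure Ω T)|
      ≤ L * (M.size + G.step) * ∫ z, |discreteFunction M G u z| ∂(spaceTimeMeasure Ω T) := by
  have hint : Integrable (fun z => discreteFunction M G u z * fderiv ℝ φ z (0, 1))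
      (spaceTimeMeasure Ω T) :=
    hu.mul_bdd (c := B) hL.continuous.aestronglyMeasurable (Eventually.of_forall hB)
  have h := abs_sum_block_sub_integral_le M G hΩb hint
    (a := fun p => u p.1 p.2 *
      ((φ (D.pt p.2, G.t (p.1 + 1)) - φ (D.pt p.2, G.t p.1)) / (G.t (p.1 + 1) - G.t p.1)))
    (r := fun p => L * (M.size + G.step) * |u p.1 p.2|) ?_
  · refine h.trans (le_of_eq ?_)
    rw [← sum_block_eq_integral M G hΩb hu.abs (a := fun p => |u p.1 p.2|)
      fun p hp z hz => by rw [discreteFunction_eq M G hp hz], Finset.mul_sum]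
    exact Finset.sum_congr rfl fun p _ => by ring
  · intro p hp z hz
    have hder : ∀ s, HasDerivAt (fun s => φ (D.pt p.2, s)) (fderiv ℝ φ (D.pt p.2, s) (0, 1)) s :=
      fun s => hasDerivAt_slice hφ _ s
    obtain ⟨ξ, hξ, hξ'⟩ := exists_hasDerivAt_eq_slope (fun s => φ (D.pt p.2, s)) _
      (G.t_lt p.1 (lt_of_mem_blockIndex hp))
      (fun s _ => (hder s).continuousAt.continuousWithinAt) fun s _ => hder s
    rw [← hξ', discreteFunction_eq M G hp hz, ← mul_sub, abs_mul, mul_comm]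
    refine mul_le_mul_of_nonneg_right ?_ (abs_nonneg _)
    refine (hL.dist_le_mul (D.pt p.2, ξ) z).trans (mul_le_mul_of_nonneg_left ?_ L.2)
    exact dist_le_of_mem_block M G hΩb hp hz (D.pt_mem p.2) (Ioo_subset_Icc_self hξ)

end Scheme

/-! ### Consistency of the fluxes -/

section FluxEstimate

variable {d : ℕ} {Ω : Set (Space d)} {T : ℝ} {M : PolyhedralMesh Ω} {G : TimeGrid T}

lemma fluxSum_sub (V W : ℕ → M.Face → Space d) (b : ℕ → M.Cell → ℝ) :
    fluxSum M G (fun n σ => V n σ - W n σ) b = fluxSum M G V b - fluxSum M G W b := by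
  unfold fluxSum
  rw [← Finset.sum_sub_distrib]
  refine Finset.sum_congr rfl fun n _ => ?_
  rw [← mul_sub, ← Finset.sum_sub_distrib]
  congr 1
  refine Finset.sum_congr rfl fun K _ => ?_
  rw [← mul_sub, ← Finset.sum_sub_distrib]
  congr 1
  refine Finset.sum_congr rfl fun σ _ => ?_
  rw [inner_sub_left]
  ring

/-- For the fluxes of a smooth field `ψ`, the flux part of the scheme is, by the Gauss formula on
the cells, a Riemann sum of `φ div ψ`. -/
lemma abs_fluxSum_average_sub_le (hd : 1 ≤ d) (hΩb : Bornology.IsBounded Ω) (D : DualMesh M)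
    {φ : Space d × ℝ → ℝ} (hφ : Continuous φ) (hφc : HasCompactSupport φ) {Lφ : NNReal}
    (hLφ : LipschitzWith Lφ φ) {Bφ : ℝ} (hBφ : ∀ z, |φ z| ≤ Bφ)
    {ψ : Space d × ℝ → Space d} (hψ : ContDiff ℝ ∞ ψ) (hψc : HasCompactSupport ψ)
    {Ld : NNReal} (hLd : LipschitzWith Ld (spaceDivergence ψ)) {Bd : ℝ}
    (hBd : ∀ z, |spaceDivergence ψ z| ≤ Bd) :
    |fluxSum M G (fun n σ => ⨍ z in M.face σ, ψ (z, G.t n) ∂μHE[d - 1])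
          (fun n K => φ (D.pt K, G.t n))
        - ∫ z, φ z * spaceDivergence ψ z ∂(spaceTimeMeasure Ω T)|
      ≤ (Lφ * Bd + Bφ * Ld) * (spaceTimeMeasure Ω T).real univ * (M.size + G.step) := by
  have hψd := hψ.differentiable (by simp)
  have hdc := contDiff_spaceDivergence hψ
  have hdcs := hasCompactSupport_spaceDivergence hψc
  have hsum : fluxSum M G (fun n σ => ⨍ z in M.face σ, ψ (z, G.t n) ∂μHE[d - 1])
        (fun n K => φ (D.pt K, G.t n))
      = ∑ p ∈ blockIndex M G, blockVol M G p * (φ (D.pt p.2, G.t (p.1 + 1)) *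
          ⨍ x in M.cell p.2, spaceDivergence ψ (x, G.t p.1)) := by
    unfold fluxSum blockIndex
    rw [Finset.sum_product]
    refine Finset.sum_congr rfl fun n _ => ?_
    rw [Finset.mul_sum]
    refine Finset.sum_congr rfl fun K _ => ?_
    rw [sum_faceArea_mul_inner_average M hd hΩb K ((contDiff_slice hψ _).of_le (by simp))
      (hasCompactSupport_slice hψc _)]
    simp_rw [divergence_slice hψd]
    have hK : M.cellVol K * (volume.real (M.cell K))⁻¹ = 1 :=
      mul_inv_cancel₀ (cellVol_pos M hΩb K).ne'
    rw [setAverage_eq, smul_eq_mul, blockVol]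
    linear_combination (-(G.t (n + 1) - G.t n) * φ (D.pt K, G.t (n + 1)) *
      ∫ x in M.cell K, spaceDivergence ψ (x, G.t n)) * hK
  have hint : Integrable (fun z => φ z * spaceDivergence ψ z) (spaceTimeMeasure Ω T) :=
    ((hφ.mul hdc.continuous).integrable_of_hasCompactSupport hφc.mul_right).mono_measure
      Measure.restrict_le_self
  rw [hsum]
  refine (abs_sum_block_sub_integral_le M G hΩb hint
    (r := fun _ => (Lφ * Bd + Bφ * Ld) * (M.size + G.step)) ?_).trans (le_of_eq ?_)
  · intro p hp z hz
    have hlt := G.t_lt _ (lt_of_mem_blockIndex hp)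
    have h1 : |φ (D.pt p.2, G.t (p.1 + 1)) - φ z| ≤ Lφ * (M.size + G.step) :=
      (hLφ.dist_le_mul _ _).trans (mul_le_mul_of_nonneg_left
        (dist_le_of_mem_block M G hΩb hp hz (D.pt_mem _) ⟨hlt.le, le_rfl⟩) Lφ.2)
    have hvol0 := (M.volume_cell_pos p.2).ne'
    have hvolt := (volume_cell_lt_top M hΩb p.2).ne
    have hsl : IntegrableOn (fun x => spaceDivergence ψ (x, G.t p.1)) (M.cell p.2) :=
      ((contDiff_slice hdc _).continuous.integrable_of_hasCompactSupport
        (hasCompactSupport_slice hdcs _)).integrableOn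
    have h2 : |(⨍ x in M.cell p.2, spaceDivergence ψ (x, G.t p.1)) - spaceDivergence ψ z|
        ≤ Ld * (M.size + G.step) :=
      norm_setAverage_sub_le (M.measurableSet_cell _) hvol0 hvolt hsl fun x hx =>
        (hLd.dist_le_mul (x, G.t p.1) z).trans (mul_le_mul_of_nonneg_left
          (dist_le_of_mem_block M G hΩb hp hz hx ⟨le_rfl, hlt.le⟩) Ld.2)
    have h3 : |⨍ x in M.cell p.2, spaceDivergence ψ (x, G.t p.1)| ≤ Bd := by
      have := norm_setAverage_sub_le (M.measurableSet_cell p.2) hvol0 hvolt hsl (a := 0)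
        (C := Bd) fun x _ => by rw [sub_zero]; exact hBd _
      rwa [sub_zero] at this
    have hh : 0 ≤ M.size + G.step := add_nonneg (size_nonneg M) (step_nonneg G)
    calc |φ (D.pt p.2, G.t (p.1 + 1)) * (⨍ x in M.cell p.2, spaceDivergence ψ (x, G.t p.1))
            - φ z * spaceDivergence ψ z|
        = |(φ (D.pt p.2, G.t (p.1 + 1)) - φ z) * (⨍ x in M.cell p.2, spaceDivergence ψ (x, G.t p.1))
            + φ z * ((⨍ x in M.cell p.2, spaceDivergence ψ (x, G.t p.1))
              - spaceDivergence ψ z)| := by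
          congr 1
          ring
      _ ≤ (Lφ * (M.size + G.step)) * Bd + Bφ * (Ld * (M.size + G.step)) := by
          refine (abs_add_le _ _).trans ?_
          rw [abs_mul, abs_mul]
          exact add_le_add (mul_le_mul h1 h3 (abs_nonneg _) (mul_nonneg Lφ.2 hh))
            (mul_le_mul (hBφ z) h2 (abs_nonneg _) ((abs_nonneg _).trans (hBφ z)))
      _ = _ := by ring
  · rw [← Finset.sum_mul, sum_blockVol M G hΩb]
    ring

/-- Consistency of the flux part of the scheme: the numerical fluxes may be replaced by those of a
smooth field `ψ`, up to the distances of `F(u)` to `ψ` and of `u` to a smooth function `w`, with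
constants `Lφ * thetaGrad * (theta * N)` that do not depend on `ψ` and `w`. -/
lemma abs_fluxSum_sub_average_le (hd : 1 ≤ d) (hΩb : Bornology.IsBounded Ω) (D : DualMesh M)
    {F : ℝ → Space d} {Fnum : ℕ → M.Face → Space d} {u : ℕ → M.Cell → ℝ} {CF : ℝ} (hCF : 0 ≤ CF)
    (hflux : ∀ n < G.N, ∀ σ K L, M.Separates σ K L →
      ‖Fnum n σ - F (u n K)‖ ≤ CF * |u n K - u n L|)
    {N : ℕ} (hN : ∀ K, (M.facesOf K).card ≤ N)
    {φ : Space d × ℝ → ℝ} {Lφ : NNReal} (hLφ : LipschitzWith Lφ φ)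
    (hφ0 : ∀ σ K, σ ∈ M.facesOf K → (¬ ∃ K L, M.Separates σ K L) → M.faceArea σ ≠ 0 →
      ∀ s, φ (D.pt K, s) = 0)
    {ψ : Space d × ℝ → Space d} (hψ : Continuous ψ) (hψc : HasCompactSupport ψ)
    {Lψ : NNReal} (hLψ : LipschitzWith Lψ ψ) {w : Space d × ℝ → ℝ} {Lw : NNReal}
    (hLw : LipschitzWith Lw w)
    (hu : Integrable (fun z => discreteFunction M G u z - w z) (spaceTimeMeasure Ω T))
    (hFu : Integrable (fun z => F (discreteFunction M G u z) - ψ z) (spaceTimeMeasure Ω T)) :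
    |fluxSum M G Fnum (fun n K => φ (D.pt K, G.t n))
        - fluxSum M G (fun n σ => ⨍ z in M.face σ, ψ (z, G.t n) ∂μHE[d - 1])
          (fun n K => φ (D.pt K, G.t n))|
      ≤ Lφ * D.thetaGrad * (D.theta * N) *
        (CF * ∫ z, |discreteFunction M G u z - w z| ∂(spaceTimeMeasure Ω T)
          + ∫ z, ‖F (discreteFunction M G u z) - ψ z‖ ∂(spaceTimeMeasure Ω T)
          + 2 * (CF * Lw + Lψ) * (spaceTimeMeasure Ω T).real univ * (M.size + G.step)) := by
  set h := M.size + G.step with hh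
  have hsize : M.size ≤ h := le_add_of_nonneg_right (step_nonneg G)
  have hh0 : 0 ≤ h := (size_nonneg M).trans hsize
  let b : ℕ × M.Cell → ℝ := fun p => CF * |u p.1 p.2 - w (D.pt p.2, G.t p.1)|
    + ‖F (u p.1 p.2) - ψ (D.pt p.2, G.t p.1)‖ + (CF * Lw + Lψ) * h
  have hb0 : ∀ p, 0 ≤ b p := fun p => by positivity
  have hC : 0 ≤ Lφ * D.thetaGrad * (D.theta * N) := by
    have := thetaGrad_nonneg D
    have := theta_nonneg D
    positivity
  have hV : ∀ n < G.N, ∀ σ K L, M.Separates σ K L → M.faceArea σ ≠ 0 →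
      ‖Fnum n σ - ⨍ z in M.face σ, ψ (z, G.t n) ∂μHE[d - 1]‖ ≤ b (n, K) + b (n, L) := by
    intro n hn σ K L hKL hσ
    have h1 := hflux n hn σ K L hKL
    have h2 : ‖(⨍ z in M.face σ, ψ (z, G.t n) ∂μHE[d - 1]) - ψ (D.pt K, G.t n)‖ ≤ Lψ * h := by
      refine norm_average_face_sub_le hd hΩb hσ (hψ.comp (by fun_prop))
        (hasCompactSupport_slice hψc _) fun z hz => ?_
      rw [← dist_eq_norm]
      refine (hLψ.dist_le_mul _ _).trans (mul_le_mul_of_nonneg_left (le_trans ?_ hsize) Lψ.2)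
      rw [Prod.dist_eq, dist_self, max_eq_left dist_nonneg]
      exact dist_le_size M hΩb (face_subset_closure_cell M hKL.2.1 hz)
        (subset_closure (D.pt_mem K))
    have hne : (M.face σ).Nonempty := by
      rw [nonempty_iff_ne_empty]
      intro h0
      simp [PolyhedralMesh.faceArea, h0] at hσ
    obtain ⟨y, hy⟩ := hne
    have h3 : |w (D.pt K, G.t n) - w (D.pt L, G.t n)| ≤ Lw * (2 * h) := by
      refine (hLw.dist_le_mul _ _).trans (mul_le_mul_of_nonneg_left ?_ Lw.2)
      rw [Prod.dist_eq, dist_self, max_eq_left dist_nonneg]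
      have hK := dist_le_size M hΩb (subset_closure (D.pt_mem K))
        (face_subset_closure_cell M hKL.2.1 hy)
      have hL := dist_le_size M hΩb (face_subset_closure_cell M hKL.2.2 hy)
        (subset_closure (D.pt_mem L))
      exact (dist_triangle _ y _).trans (by linarith)
    have h4 : |u n K - u n L| ≤ |u n K - w (D.pt K, G.t n)| + |u n L - w (D.pt L, G.t n)|
        + Lw * (2 * h) := by
      have e1 := abs_sub_le (u n K) (w (D.pt K, G.t n)) (u n L)
      have e2 := abs_sub_le (w (D.pt K, G.t n)) (w (D.pt L, G.t n)) (u n L)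
      rw [abs_sub_comm (w (D.pt L, G.t n)) (u n L)] at e2
      linarith
    have h5 : ‖Fnum n σ - ⨍ z in M.face σ, ψ (z, G.t n) ∂μHE[d - 1]‖
        ≤ ‖Fnum n σ - F (u n K)‖ + ‖F (u n K) - ψ (D.pt K, G.t n)‖
          + ‖(⨍ z in M.face σ, ψ (z, G.t n) ∂μHE[d - 1]) - ψ (D.pt K, G.t n)‖ := by
      rw [norm_sub_rev (⨍ z in M.face σ, ψ (z, G.t n) ∂μHE[d - 1])]
      refine le_trans (le_of_eq ?_) norm_add₃_le
      congr 1
      abel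
    have h6 := mul_le_mul_of_nonneg_left h4 hCF
    have h7 : 0 ≤ ‖F (u n L) - ψ (D.pt L, G.t n)‖ := norm_nonneg _
    have h8 : 0 ≤ Lψ * h := by positivity
    simp only [b]
    linarith
  have hmain : |fluxSum M G Fnum (fun n K => φ (D.pt K, G.t n))
        - fluxSum M G (fun n σ => ⨍ z in M.face σ, ψ (z, G.t n) ∂μHE[d - 1])
          (fun n K => φ (D.pt K, G.t n))|
      ≤ Lφ * D.thetaGrad * (D.theta * N) * ∑ p ∈ blockIndex M G, blockVol M G p * b p := by
    rw [← fluxSum_sub]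
    unfold fluxSum blockIndex
    rw [Finset.sum_product, Finset.mul_sum]
    refine (Finset.abs_sum_le_sum_abs _ _).trans (Finset.sum_le_sum fun n hn => ?_)
    have hn' := Finset.mem_range.1 hn
    have hδ : 0 ≤ G.t (n + 1) - G.t n := sub_nonneg.2 (G.t_lt n hn').le
    rw [abs_mul, abs_of_nonneg hδ]
    refine (mul_le_mul_of_nonneg_left (abs_sum_flux_le hΩb D Lφ.2 (b := fun K => b (n, K)) ?_ ?_
      (fun K => hb0 _) (hV n hn') hN) hδ).trans (le_of_eq ?_)
    · intro K L
      refine (hLφ.dist_le_mul _ _).trans_eq ?_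
      rw [Prod.dist_eq, dist_self, max_eq_left dist_nonneg]
      rfl
    · exact fun σ K hK hσ hA => hφ0 σ K hK hσ hA _
    · simp only [blockVol]
      rw [mul_left_comm]
      congr 1
      rw [Finset.mul_sum]
      exact Finset.sum_congr rfl fun K _ => by ring
  refine hmain.trans (mul_le_mul_of_nonneg_left ?_ hC)
  have hleft : ∀ p ∈ blockIndex M G, ∀ z ∈ block M G p, dist (D.pt p.2, G.t p.1) z ≤ h :=
    fun p hp z hz => dist_le_of_mem_block M G hΩb hp hz (D.pt_mem _)
      ⟨le_rfl, (G.t_lt _ (lt_of_mem_blockIndex hp)).le⟩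
  have hw := sum_block_le_integral_add M G hΩb hu.abs (r := Lw * h)
    (a := fun p => |u p.1 p.2 - w (D.pt p.2, G.t p.1)|) fun p hp z hz => by
      rw [discreteFunction_eq M G hp hz]
      refine (abs_abs_sub_abs_le_abs_sub _ _).trans ?_
      rw [sub_sub_sub_cancel_left, abs_sub_comm]
      exact (hLw.dist_le_mul _ _).trans (mul_le_mul_of_nonneg_left (hleft p hp z hz) Lw.2)
  have hψ' := sum_block_le_integral_add M G hΩb hFu.norm (r := Lψ * h)
    (a := fun p => ‖F (u p.1 p.2) - ψ (D.pt p.2, G.t p.1)‖) fun p hp z hz => by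
      rw [discreteFunction_eq M G hp hz]
      refine (abs_norm_sub_norm_le _ _).trans ?_
      rw [sub_sub_sub_cancel_left, norm_sub_rev, ← dist_eq_norm]
      exact (hLψ.dist_le_mul _ _).trans (mul_le_mul_of_nonneg_left (hleft p hp z hz) Lψ.2)
  have hsum : ∑ p ∈ blockIndex M G, blockVol M G p * b p
      = CF * ∑ p ∈ blockIndex M G, blockVol M G p * |u p.1 p.2 - w (D.pt p.2, G.t p.1)|
        + ∑ p ∈ blockIndex M G, blockVol M G p * ‖F (u p.1 p.2) - ψ (D.pt p.2, G.t p.1)‖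
        + (CF * Lw + Lψ) * h * ∑ p ∈ blockIndex M G, blockVol M G p := by
    rw [Finset.mul_sum, Finset.mul_sum, ← Finset.sum_add_distrib, ← Finset.sum_add_distrib]
    exact Finset.sum_congr rfl fun p _ => by simp only [b]; ring
  rw [hsum]
  rw [sum_blockVol M G hΩb] at hw hψ' ⊢
  have := mul_le_mul_of_nonneg_left hw hCF
  nlinarith [this, hψ']

/-- A cell with a boundary face of positive area lies near `∂Ω`, where a compactly supported
function vanishes once the mesh is fine. -/
lemma eq_zero_of_boundary_face (hΩo : IsOpen Ω) (hΩb : Bornology.IsBounded Ω) (D : DualMesh M)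
    {φ : Space d × ℝ → ℝ} {δ : ℝ}
    (hδ : Metric.thickening δ (Prod.fst '' tsupport φ) ⊆ Ω) (hsize : M.size < δ)
    {σ : M.Face} {K : M.Cell} (hK : σ ∈ M.facesOf K) (hσ : ¬ ∃ K L, M.Separates σ K L)
    (hA : M.faceArea σ ≠ 0) (s : ℝ) : φ (D.pt K, s) = 0 := by
  by_contra hne
  have hmem : D.pt K ∈ Prod.fst '' tsupport φ := ⟨(D.pt K, s), subset_tsupport φ hne, rfl⟩
  have hnonempty : (M.face σ).Nonempty := by
    rw [nonempty_iff_ne_empty]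
    intro h0
    simp [PolyhedralMesh.faceArea, h0] at hA
  obtain ⟨y, hy⟩ := hnonempty
  have hyΩ : y ∈ Ω := by
    refine hδ (Metric.mem_thickening_iff.2 ⟨D.pt K, hmem, lt_of_le_of_lt ?_ hsize⟩)
    exact dist_le_size M hΩb (face_subset_closure_cell M hK hy) (subset_closure (D.pt_mem K))
  have hyf := M.face_subset_frontier σ hσ hy
  rw [hΩo.frontier_eq] at hyf
  exact hyf.2 hyΩ

end FluxEstimate

/-! ### Passage to the limit -/

section Limit

variable {d : ℕ} {Ω : Set (Space d)} {T : ℝ}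

lemma integrable_of_memLp_one {α E : Type*} [MeasurableSpace α] [NormedAddCommGroup E]
    {μ : Measure α} {f : α → E} (hf : MemLp f 1 μ) : Integrable f μ := memLp_one_iff_integrable.1 hf

lemma integral_norm_eq_toReal_eLpNorm {α E : Type*} [MeasurableSpace α] [NormedAddCommGroup E]
    {μ : Measure α} {f : α → E} (hf : AEStronglyMeasurable f μ) :
    ∫ z, ‖f z‖ ∂μ = (eLpNorm f 1 μ).toReal := by
  rw [integral_norm_eq_lintegral_enorm hf, eLpNorm_one_eq_lintegral_enorm]

lemma TendstoInL1.tendsto_integral_norm_sub {α E : Type*} [MeasurableSpace α]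
    [NormedAddCommGroup E] {μ : Measure α} {f : ℕ → α → E} {g : α → E} (h : TendstoInL1 μ f g) :
    Tendsto (fun m => ∫ z, ‖f m z - g z‖ ∂μ) atTop (𝓝 0) := by
  have h1 := (ENNReal.tendsto_toReal ENNReal.zero_ne_top).comp h.2.2
  rw [ENNReal.toReal_zero] at h1
  refine h1.congr fun m => ?_
  exact (integral_norm_eq_toReal_eLpNorm ((h.1 m).1.sub h.2.1.1)).symm

lemma exists_smooth_integral_norm_sub_le {E F : Type*} [NormedAddCommGroup E] [NormedSpace ℝ E]
    [FiniteDimensional ℝ E] [MeasurableSpace E] [BorelSpace E] [NormedAddCommGroup F]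
    [NormedSpace ℝ F] {μ : Measure E} [IsFiniteMeasureOnCompacts μ] {f : E → F}
    (hf : Integrable f μ) {ε : ℝ} (hε : 0 < ε) :
    ∃ g : E → F, HasCompactSupport g ∧ ContDiff ℝ ∞ g ∧ Integrable g μ ∧
      ∫ z, ‖f z - g z‖ ∂μ ≤ ε := by
  obtain ⟨g, hgc, hg, hle⟩ := (memLp_one_iff_integrable.2 hf).exist_eLpNorm_sub_le
    ENNReal.one_ne_top le_rfl hε
  have hgi : Integrable g μ := hg.continuous.integrable_of_hasCompactSupport hgc
  refine ⟨g, hgc, hg, hgi, ?_⟩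
  have h := integral_norm_eq_toReal_eLpNorm (hf.sub hgi).1
  simp only [Pi.sub_apply] at h
  rw [h]
  exact ENNReal.toReal_le_of_le_ofReal hε.le hle

lemma integral_norm_sub_le_add {α E : Type*} [MeasurableSpace α] [NormedAddCommGroup E]
    {μ : Measure α} {f g k : α → E} (hf : Integrable f μ) (hg : Integrable g μ)
    (hk : Integrable k μ) :
    ∫ z, ‖f z - k z‖ ∂μ ≤ ∫ z, ‖f z - g z‖ ∂μ + ∫ z, ‖g z - k z‖ ∂μ := by
  refine (integral_mono (g := fun z => ‖f z - g z‖ + ‖g z - k z‖) (hf.sub hk).norm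
    ((hf.sub hg).norm.add (hg.sub hk).norm)
    fun z => norm_sub_le_norm_sub_add_norm_sub _ _ _).trans_eq ?_
  exact integral_add (hf.sub hg).norm (hg.sub hk).norm

lemma integrable_fderiv_apply {φ : Space d × ℝ → ℝ} (hφ : ContDiff ℝ ∞ φ) {B : ℝ}
    (hB : ∀ z, ‖fderiv ℝ φ z‖ ≤ B) {μ : Measure (Space d × ℝ)} {V : Space d × ℝ → Space d}
    (hV : Integrable V μ) : Integrable (fun z => fderiv ℝ φ z (V z, 0)) μ := by
  have hmeas : AEStronglyMeasurable (fun z => fderiv ℝ φ z (V z, 0)) μ := by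
    have h1 : Continuous fun q : (Space d × ℝ →L[ℝ] ℝ) × Space d => q.1 (q.2, 0) := by fun_prop
    exact h1.comp_aestronglyMeasurable
      ((hφ.continuous_fderiv (by simp)).aestronglyMeasurable.prodMk hV.1)
  refine (hV.norm.const_mul B).mono' hmeas (Eventually.of_forall fun z => ?_)
  refine ((fderiv ℝ φ z).le_opNorm _).trans ?_
  rw [Prod.norm_mk, norm_zero, max_eq_left (norm_nonneg _)]
  exact mul_le_mul_of_nonneg_right (hB z) (norm_nonneg _)

lemma abs_integral_fderiv_apply_sub_le {φ : Space d × ℝ → ℝ} (hφ : ContDiff ℝ ∞ φ) {B : ℝ}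
    (hB : ∀ z, ‖fderiv ℝ φ z‖ ≤ B) {μ : Measure (Space d × ℝ)} {V W : Space d × ℝ → Space d}
    (hV : Integrable V μ) (hW : Integrable W μ) :
    |∫ z, fderiv ℝ φ z (V z, 0) ∂μ - ∫ z, fderiv ℝ φ z (W z, 0) ∂μ|
      ≤ B * ∫ z, ‖V z - W z‖ ∂μ := by
  rw [← integral_sub (integrable_fderiv_apply hφ hB hV) (integrable_fderiv_apply hφ hB hW),
    ← integral_const_mul, ← Real.norm_eq_abs]
  refine norm_integral_le_of_norm_le ((hV.sub hW).norm.const_mul B)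
    (Eventually.of_forall fun z => ?_)
  rw [← map_sub, Prod.mk_sub_mk, sub_zero]
  refine ((fderiv ℝ φ z).le_opNorm _).trans ?_
  rw [Prod.norm_mk, norm_zero, max_eq_left (norm_nonneg _)]
  exact mul_le_mul_of_nonneg_right (hB z) (norm_nonneg _)

variable {M : ℕ → PolyhedralMesh Ω} {G : ℕ → TimeGrid T}

/-- The initial and time parts of the discrete weak form converge. -/
lemma tendsto_time_part (hΩb : Bornology.IsBounded Ω) (D : ∀ m, DualMesh (M m))
    (hsize : Tendsto (fun m => (M m).size) atTop (𝓝 0))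
    (hstep : Tendsto (fun m => (G m).step) atTop (𝓝 0))
    {u₀ : Space d → ℝ} (hu₀ : IntegrableOn u₀ Ω) {u : ∀ m, ℕ → (M m).Cell → ℝ}
    (hinit : ∀ m K, u m 0 K = (1 / (M m).cellVol K) * ∫ x in (M m).cell K, u₀ x)
    {ubar : Space d × ℝ → ℝ}
    (hu : TendstoInL1 (spaceTimeMeasure Ω T)
      (fun m => discreteFunction (M m) (G m) (u m)) ubar)
    {φ : Space d × ℝ → ℝ} (hφ : ContDiff ℝ ∞ φ) (hφc : HasCompactSupport φ) :
    Tendsto (fun m => ∑ K, (M m).cellVol K * (u m 0 K * φ ((D m).pt K, (G m).t 0)) +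
      ∑ p ∈ blockIndex (M m) (G m), blockVol (M m) (G m) p * (u m p.1 p.2 *
          ((φ ((D m).pt p.2, (G m).t (p.1 + 1)) - φ ((D m).pt p.2, (G m).t p.1))
            / ((G m).t (p.1 + 1) - (G m).t p.1)))) atTop
      (𝓝 ((∫ x in Ω, u₀ x * φ (x, 0))
        + ∫ z, ubar z * fderiv ℝ φ z (0, 1) ∂(spaceTimeMeasure Ω T))) := by
  have hφd := hφ.differentiable (by simp)
  obtain ⟨Lφ, hLφ⟩ := hφ.lipschitzWith_of_hasCompactSupport hφc (by simp)
  obtain ⟨Bφ, hBφ⟩ := hφ.continuous.bounded_above_of_compact_support hφc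
  have hτ := contDiff_fderiv_apply hφ (0, 1)
  have hτc : HasCompactSupport fun z => fderiv ℝ φ z (0, 1) := hφc.fderiv_apply ℝ _
  obtain ⟨Lτ, hLτ⟩ := hτ.lipschitzWith_of_hasCompactSupport hτc (by simp)
  obtain ⟨Bτ, hBτ⟩ := hτ.continuous.bounded_above_of_compact_support hτc
  have hh : Tendsto (fun m => (M m).size + (G m).step) atTop (𝓝 0) := by
    simpa using hsize.add hstep
  have hui := fun m => integrable_of_memLp_one (hu.1 m)
  have hubar := integrable_of_memLp_one hu.2.1
  have hlim := TendstoInL1.tendsto_integral_norm_sub hu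
  refine Tendsto.add ?_ ?_
  · rw [tendsto_iff_dist_tendsto_zero]
    refine squeeze_zero (g := fun m => Lφ * (M m).size * ∫ x in Ω, |u₀ x|)
      (fun _ => dist_nonneg) (fun m => ?_)
      (by simpa using (hsize.const_mul (Lφ : ℝ)).mul_const (∫ x in Ω, |u₀ x|))
    have hL0 : LipschitzWith Lφ fun x : Space d => φ (x, 0) := by
      simpa [Function.comp_def] using hLφ.comp (LipschitzWith.prodMk_right (0 : ℝ))
    have := abs_initial_sub_le hΩb (D m) hu₀ hL0 (fun x => hBφ (x, 0))
    simp only [(G m).t_zero, hinit, Real.dist_eq]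
    exact this
  · have hτlim : Tendsto (fun m => ∫ z, discreteFunction (M m) (G m) (u m) z
        * fderiv ℝ φ z (0, 1) ∂(spaceTimeMeasure Ω T)) atTop
        (𝓝 (∫ z, ubar z * fderiv ℝ φ z (0, 1) ∂(spaceTimeMeasure Ω T))) := by
      rw [tendsto_iff_dist_tendsto_zero]
      refine squeeze_zero (fun _ => dist_nonneg) (fun m => ?_)
        (by simpa using hlim.mul_const Bτ)
      have hprod : ∀ {f : Space d × ℝ → ℝ}, Integrable f (spaceTimeMeasure Ω T) →
          Integrable (fun z => f z * fderiv ℝ φ z (0, 1)) (spaceTimeMeasure Ω T) := fun hf =>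
        hf.mul_bdd (c := Bτ) hτ.continuous.aestronglyMeasurable (Eventually.of_forall hBτ)
      rw [dist_eq_norm, ← integral_sub (hprod (hui m)) (hprod hubar), ← integral_mul_const]
      refine norm_integral_le_of_norm_le (((hui m).sub hubar).norm.mul_const Bτ)
        (Eventually.of_forall fun z => ?_)
      rw [← sub_mul, norm_mul]
      exact mul_le_mul_of_nonneg_left (hBτ z) (norm_nonneg _)
    refine hτlim.congr_dist ?_
    refine squeeze_zero (g := fun m => Lτ * ((M m).size + (G m).step) *
      (∫ z, ‖discreteFunction (M m) (G m) (u m) z - ubar z‖ ∂(spaceTimeMeasure Ω T)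
        + ∫ z, ‖ubar z‖ ∂(spaceTimeMeasure Ω T))) (fun _ => dist_nonneg) (fun m => ?_)
      (by simpa using (hh.const_mul (Lτ : ℝ)).mul (hlim.add_const _))
    rw [dist_comm, Real.dist_eq]
    refine (abs_time_sub_le hΩb (D m) (hui m) hφd hLτ hBτ).trans ?_
    have h1 := integral_norm_sub_le_add (hui m) hubar (integrable_zero _ ℝ _)
    simp only [Pi.zero_apply, sub_zero] at h1
    have h2 := size_nonneg (M m)
    have h3 := step_nonneg (G m)
    exact mul_le_mul_of_nonneg_left h1 (by positivity)

/-- The flux part of the discrete weak form converges. -/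
lemma tendsto_fluxSum (hd : 1 ≤ d) (hΩo : IsOpen Ω) (hΩb : Bornology.IsBounded Ω)
    {F : ℝ → Space d} (D : ∀ m, DualMesh (M m))
    (hsize : Tendsto (fun m => (M m).size) atTop (𝓝 0))
    (hstep : Tendsto (fun m => (G m).step) atTop (𝓝 0))
    {Fnum : ∀ m, ℕ → (M m).Face → Space d} {u : ∀ m, ℕ → (M m).Cell → ℝ}
    {ubar : Space d × ℝ → ℝ}
    (hu : TendstoInL1 (spaceTimeMeasure Ω T)
      (fun m => discreteFunction (M m) (G m) (u m)) ubar)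
    (hFu : TendstoInL1 (spaceTimeMeasure Ω T)
      (fun m z => F (discreteFunction (M m) (G m) (u m) z)) (fun z => F (ubar z)))
    {Θg : ℝ} (hΘg : ∀ m, (D m).thetaGrad ≤ Θg) {CF : ℝ} (hCF : 0 ≤ CF)
    (hflux : ∀ m, ∀ n < (G m).N, ∀ σ K L, (M m).Separates σ K L →
      ‖Fnum m n σ - F (u m n K)‖ ≤ CF * |u m n K - u m n L|)
    {Θ : ℝ} (hΘ : ∀ m, (D m).theta ≤ Θ) {N : ℕ} (hN : ∀ m, ∀ K, ((M m).facesOf K).card ≤ N)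
    {φ : Space d × ℝ → ℝ} (hφ : ContDiff ℝ ∞ φ) (hφc : HasCompactSupport φ)
    (hφs : tsupport φ ⊆ Ω ×ˢ Iio T) :
    Tendsto (fun m => fluxSum (M m) (G m) (Fnum m) fun n K => φ ((D m).pt K, (G m).t n)) atTop
      (𝓝 (-∫ z, fderiv ℝ φ z (F (ubar z), 0) ∂(spaceTimeMeasure Ω T))) := by
  set μ := spaceTimeMeasure Ω T with hμ
  have hfinμ : IsFiniteMeasure μ := isFiniteMeasure_spaceTimeMeasure hΩb T
  have hh : Tendsto (fun m => (M m).size + (G m).step) atTop (𝓝 0) := by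
    simpa using hsize.add hstep
  obtain ⟨Lφ, hLφ⟩ := hφ.lipschitzWith_of_hasCompactSupport hφc (by simp)
  obtain ⟨Bφ, hBφ⟩ := hφ.continuous.bounded_above_of_compact_support hφc
  obtain ⟨B', hB'⟩ := (hφ.continuous_fderiv (by simp)).bounded_above_of_compact_support
    (hφc.fderiv ℝ)
  have hB'0 : 0 ≤ B' := (norm_nonneg _).trans (hB' 0)
  obtain ⟨δ, hδ0, hδ⟩ := (IsCompact.image hφc continuous_fst).exists_thickening_subset_open hΩo
    (by rintro _ ⟨z, hz, rfl⟩; exact (hφs hz).1)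
  have hui := fun m => integrable_of_memLp_one (hu.1 m)
  have hubar := integrable_of_memLp_one hu.2.1
  have hFi := fun m => integrable_of_memLp_one (hFu.1 m)
  have hFbar := integrable_of_memLp_one hFu.2.1
  have hlimu := TendstoInL1.tendsto_integral_norm_sub hu
  have hlimF := TendstoInL1.tendsto_integral_norm_sub hFu
  have hΘg0 : 0 ≤ Θg := (thetaGrad_nonneg (D 0)).trans (hΘg 0)
  have hΘ0 : 0 ≤ Θ := (theta_nonneg (D 0)).trans (hΘ 0)
  set C : ℝ := Lφ * Θg * (Θ * N) with hC
  have hC0 : 0 ≤ C := by positivity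
  rw [Metric.tendsto_nhds]
  intro ε hε
  -- the total weight of the two smooth approximations in the error
  set A : ℝ := C * (CF + 1) + B' with hA
  have hA0 : 0 ≤ A := by positivity
  set η : ℝ := ε / (A + 1) with hη
  have hη0 : 0 < η := by positivity
  -- `ψ` and `w` depend on `ε` only, so that their Lipschitz constants are fixed as `m → ∞`
  obtain ⟨ψ, hψc, hψ, hψi, hψη⟩ := exists_smooth_integral_norm_sub_le hFbar hη0
  obtain ⟨w, hwc, hw, hwi, hwη⟩ := exists_smooth_integral_norm_sub_le hubar hη0
  obtain ⟨Lψ, hLψ⟩ := hψ.lipschitzWith_of_hasCompactSupport hψc (by simp)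
  obtain ⟨Lw, hLw⟩ := hw.lipschitzWith_of_hasCompactSupport hwc (by simp)
  have hdc := contDiff_spaceDivergence hψ
  have hdcs := hasCompactSupport_spaceDivergence hψc
  obtain ⟨Ld, hLd⟩ := hdc.lipschitzWith_of_hasCompactSupport hdcs (by simp)
  obtain ⟨Bd, hBd⟩ := hdc.continuous.bounded_above_of_compact_support hdcs
  let r : ℕ → ℝ := fun m =>
    C * (CF * (∫ z, ‖discreteFunction (M m) (G m) (u m) z - ubar z‖ ∂μ + η)
        + (∫ z, ‖F (discreteFunction (M m) (G m) (u m) z) - F (ubar z)‖ ∂μ + η)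
        + 2 * (CF * Lw + Lψ) * μ.real univ * ((M m).size + (G m).step))
      + (Lφ * Bd + Bφ * Ld) * μ.real univ * ((M m).size + (G m).step) + B' * η
  have hr : Tendsto r atTop (𝓝 (A * η)) := by
    have h1 := ((((hlimu.add_const η).const_mul CF).add (hlimF.add_const η)).add
      (hh.const_mul (2 * (CF * Lw + Lψ) * μ.real univ))).const_mul C
    have h2 := (h1.add (hh.const_mul ((Lφ * Bd + Bφ * Ld) * μ.real univ))).add_const (B' * η)
    have h3 : C * (CF * (0 + η) + (0 + η) + 2 * (CF * Lw + Lψ) * μ.real univ * 0)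
        + (Lφ * Bd + Bφ * Ld) * μ.real univ * 0 + B' * η = A * η := by
      rw [hA]
      ring
    rw [h3] at h2
    exact h2
  have hAη : A * η < ε := by
    rw [hη, mul_div_assoc', div_lt_iff₀ (by positivity)]
    nlinarith
  filter_upwards [hr.eventually_lt_const hAη, hsize.eventually_lt_const hδ0] with m hrm hδm
  refine lt_of_le_of_lt ?_ hrm
  have hdiffu := (hui m).sub hwi
  have hdiffF := (hFi m).sub hψi
  have e1 := abs_fluxSum_sub_average_le hd hΩb (D m) hCF (hflux m) (hN m) hLφ
    (fun σ K hK hσ hAσ s => eq_zero_of_boundary_face hΩo hΩb (D m) hδ hδm hK hσ hAσ s)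
    hψ.continuous hψc hLψ hLw hdiffu hdiffF
  have e2 := abs_fluxSum_average_sub_le (G := G m) hd hΩb (D m) hφ.continuous hφc hLφ hBφ
    hψ hψc hLd hBd
  have e3 := abs_integral_fderiv_apply_sub_le hφ hB' hFbar hψi
  rw [integral_mul_spaceDivergence hφ hφc hφs hψ hψc] at e2
  have e4 := integral_norm_sub_le_add (hui m) hubar hwi
  have e5 := integral_norm_sub_le_add (hFi m) hFbar hψi
  have hconst : Lφ * (D m).thetaGrad * ((D m).theta * N) ≤ C := by
    have h1 := thetaGrad_nonneg (D m)
    have h2 := theta_nonneg (D m)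
    have h3 := hΘ m
    have h4 := hΘg m
    rw [hC]
    gcongr
  have hh0 : 0 ≤ (M m).size + (G m).step := add_nonneg (size_nonneg _) (step_nonneg _)
  have hX : CF * ∫ z, |discreteFunction (M m) (G m) (u m) z - w z| ∂μ
          + ∫ z, ‖F (discreteFunction (M m) (G m) (u m) z) - ψ z‖ ∂μ
          + 2 * (CF * Lw + Lψ) * μ.real univ * ((M m).size + (G m).step)
      ≤ CF * (∫ z, ‖discreteFunction (M m) (G m) (u m) z - ubar z‖ ∂μ + η)
        + (∫ z, ‖F (discreteFunction (M m) (G m) (u m) z) - F (ubar z)‖ ∂μ + η)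
        + 2 * (CF * Lw + Lψ) * μ.real univ * ((M m).size + (G m).step) := by
    have e6 : ∫ z, |discreteFunction (M m) (G m) (u m) z - w z| ∂μ
        ≤ ∫ z, ‖discreteFunction (M m) (G m) (u m) z - ubar z‖ ∂μ + η :=
      e4.trans (by linarith)
    have e7 : ∫ z, ‖F (discreteFunction (M m) (G m) (u m) z) - ψ z‖ ∂μ
        ≤ ∫ z, ‖F (discreteFunction (M m) (G m) (u m) z) - F (ubar z)‖ ∂μ + η :=
      e5.trans (by linarith)
    have := mul_le_mul_of_nonneg_left e6 hCF
    linarith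
  have hX0 : 0 ≤ CF * ∫ z, |discreteFunction (M m) (G m) (u m) z - w z| ∂μ
          + ∫ z, ‖F (discreteFunction (M m) (G m) (u m) z) - ψ z‖ ∂μ
          + 2 * (CF * Lw + Lψ) * μ.real univ * ((M m).size + (G m).step) := by
    have h1 : 0 ≤ ∫ z, |discreteFunction (M m) (G m) (u m) z - w z| ∂μ :=
      integral_nonneg fun _ => abs_nonneg _
    have h2 : 0 ≤ ∫ z, ‖F (discreteFunction (M m) (G m) (u m) z) - ψ z‖ ∂μ :=
      integral_nonneg fun _ => norm_nonneg _
    positivity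
  have e8 := e1.trans (mul_le_mul hconst hX hX0 hC0)
  have e9 := e3.trans (mul_le_mul_of_nonneg_left hψη hB'0)
  rw [Real.dist_eq]
  simp only [r]
  rw [abs_le] at e8 e2 e9 ⊢
  constructor <;> linarith [e8.1, e8.2, e2.1, e2.2, e9.1, e9.2]

end Limit

end LaxWendroff

theorem theorem1 {d : ℕ} (hd : 1 ≤ d) (Ω : Set (Space d)) (hΩo : IsOpen Ω)
    (hΩb : Bornology.IsBounded Ω) (T : ℝ) (hT : 0 < T)
    (F : ℝ → Space d) (hF : Continuous F)
    (u₀ : Space d → ℝ) (hu₀ : IntegrableOn u₀ Ω)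
    -- the meshes, with their points `x_K` and dual cells `D_σ`, and the time grids
    (M : ℕ → PolyhedralMesh Ω) (D : ∀ m, DualMesh (M m)) (G : ℕ → TimeGrid T)
    (hsize : Tendsto (fun m => (M m).size) atTop (𝓝 0))
    (hstep : Tendsto (fun m => (G m).step) atTop (𝓝 0))
    -- the numerical fluxes `F_σ^n` and the discrete solutions
    (Fnum : ∀ m, ℕ → (M m).Face → Space d) (u : ∀ m, ℕ → (M m).Cell → ℝ)
    (hscheme : ∀ m, IsFiniteVolumeSolution (M m) (G m) u₀ (Fnum m) (u m))
    -- convergence of the discrete solutions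
    (ubar : Space d × ℝ → ℝ)
    (hu : TendstoInL1 (spaceTimeMeasure Ω T)
      (fun m => discreteFunction (M m) (G m) (u m)) ubar)
    -- (i) convergence of the fluxes of the discrete solutions
    (hFu : TendstoInL1 (spaceTimeMeasure Ω T)
      (fun m z => F (discreteFunction (M m) (G m) (u m) z)) (fun z => F (ubar z)))
    -- (ii) mesh regularity related to the discrete gradient
    (hthetaGrad : ∃ θ : ℝ, ∀ m, (D m).thetaGrad ≤ θ)
    -- (iii) lip-diag numerical flux
    (hflux : ∃ CF : ℝ, ∀ m, ∀ n < (G m).N, ∀ σ K L, (M m).Separates σ K L →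
      ‖Fnum m n σ - F (u m n K)‖ ≤ CF * |u m n K - u m n L| ∧
      ‖Fnum m n σ - F (u m n L)‖ ≤ CF * |u m n K - u m n L|)
    -- (iv) mesh regularity related to the discrete translations
    (htheta : ∃ θ : ℝ, ∀ m, (D m).theta ≤ θ)
    (hfaces : ∃ Nfaces : ℕ, ∀ m, ∀ K, ((M m).facesOf K).card ≤ Nfaces) :
    IsWeakSolution Ω T F u₀ ubar := by
  obtain ⟨Θg, hΘg⟩ := hthetaGrad
  obtain ⟨CF, hCF⟩ := hflux
  obtain ⟨Θ, hΘ⟩ := htheta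
  obtain ⟨N, hN⟩ := hfaces
  have hubar := LaxWendroff.integrable_of_memLp_one hu.2.1
  have hFbar := LaxWendroff.integrable_of_memLp_one hFu.2.1
  refine ⟨hubar, hFbar, fun φ hφ hφc hφs => ?_⟩
  have hφd := hφ.differentiable (by simp)
  have hflux' : ∀ m, ∀ n < (G m).N, ∀ σ K L, (M m).Separates σ K L →
      ‖Fnum m n σ - F (u m n K)‖ ≤ max CF 0 * |u m n K - u m n L| := fun m n hn σ K L h =>
    (hCF m n hn σ K L h).1.trans (mul_le_mul_of_nonneg_right (le_max_left _ _) (abs_nonneg _))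
  have h1 := LaxWendroff.tendsto_fluxSum hd hΩo hΩb D hsize hstep hu hFu hΘg (le_max_right CF 0)
    hflux' hΘ hN hφ hφc hφs
  have h2 := LaxWendroff.tendsto_time_part hΩb D hsize hstep hu₀ (fun m => (hscheme m).1) hu hφ hφc
  have hlast : ∀ m K, φ ((D m).pt K, (G m).t (G m).N) = 0 := fun m K => by
    refine image_eq_zero_of_notMem_tsupport fun h => ?_
    have : (G m).t (G m).N < T := (hφs h).2
    exact this.ne (G m).t_last
  have h3 := tendsto_nhds_unique h1 (h2.congr fun m =>
    (LaxWendroff.fluxSum_eq (hscheme m) (b := fun n K => φ ((D m).pt K, (G m).t n)) (hlast m)).symm)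
  obtain ⟨B, hB⟩ := (hφ.continuous_fderiv (by simp)).bounded_above_of_compact_support
    (hφc.fderiv ℝ)
  have hi1 : Integrable (fun z => ubar z * fderiv ℝ φ z (0, 1)) (spaceTimeMeasure Ω T) := by
    have hτ := LaxWendroff.contDiff_fderiv_apply hφ (0, 1)
    obtain ⟨Bτ, hBτ⟩ := hτ.continuous.bounded_above_of_compact_support (hφc.fderiv_apply ℝ _)
    exact hubar.mul_bdd hτ.continuous.aestronglyMeasurable (Eventually.of_forall hBτ)
  have hi2 := LaxWendroff.integrable_fderiv_apply hφ hB hFbar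
  have h4 : ∀ z : Space d × ℝ, ubar z * deriv (fun s => φ (z.1, s)) z.2
      + inner ℝ (F (ubar z)) (gradient (fun x => φ (x, z.2)) z.1)
      = ubar z * fderiv ℝ φ z (0, 1) + fderiv ℝ φ z (F (ubar z), 0) := fun z => by
    rw [(LaxWendroff.hasDerivAt_slice hφd z.1 z.2).deriv, inner_gradient_right,
      LaxWendroff.fderiv_slice hφd]
    rfl
  simp_rw [h4]
  rw [integral_add hi1 hi2]
  linarith
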